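/- **Setting.** Let $f_1,\dots,f_m:\mathbb R^n\to\mathbb R$ be differentiable, with $\|\nabla f_i(y)-\nabla f_i(x)\|\le L_i\|y-x\|$ for all $x,y$ and some $L_i>0$, and put $L=\max_i L_i$. Let the total cost $f=\frac1m\sum_{i=1}^m f_i$ be $\mu$-strongly convex for some $\mu>0$, i.e. $f(y)\ge f(x)+(y-x)^T\nabla f(x)+\frac\mu2\|y-x\|^2$ for all $x,y$ (the $f_i$ need not be convex). Let $W=(w_{ij})$ be a doubly stochastic $m\times m$ matrix with nonnegative entries and $w_{ii}>0$ for all $i$, such that for $i\ne j$ one has $w_{ij}\neq0$ if and only if $\{i,j\}$ is an edge of a given connected undirected graph on $\{1,\dots,m\}$. Let $\beta$ be the spectral norm of $W-\frac1m\mathbf 1\mathbf 1^T$, and $\eta=\frac{\mu L}{\mu+L}$. Let $0<p<1$, $a>0$, $w\ge1$, $\alpha(t)=\frac{a}{(t+w)^p}$, with $$\alpha(0)=\frac a{w^p}\le\min\Big\{\frac2{\mu+L},\ \frac{\eta(1-\beta)}{L(\eta+L)}\Big\}.$$ For arbitrary initial points $x_i(0)\in\mathbb R^n$ let $x_i(t+1)=\sum_{j=1}^m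 w_{ij}x_j(t)-\alpha(t)\nabla f_i(x_i(t))$ for $t\ge0$. Write $\mathbf x(t)=(x_1(t),\dots,x_m(t))$, $\bar x(t)=\frac1m\sum_k x_k(t)$, $\bar{\mathbf x}(t)=(\bar x(t),\dots,\bar x(t))$, and $\|X\|=(\sum_i\|X_i\|^2)^{1/2}$ for $X\in(\mathbb R^n)^m$. **Theorem.** The function $f$ has a unique minimizer $x_*$; with $\mathbf x_*=(x_*,\dots,x_*)$, there is a constant $R>0$ such that $\|\bar{\mathbf x}(t)-\mathbf x_*\|\le R$ and $\|\mathbf x(t)-\bar{\mathbf x}(t)\|\le R$ for all $t\ge0$. For any such $R$, put $D=\max_i\|\nabla f_i(x_*)\|$, $d=2LR+\sqrt m\,D$, $R_0=\|\mathbf x(0)-\bar{\mathbf x}(0)\|+\frac{d\,\alpha(0)}{1-\beta}$, $Q_1=\big(\frac{w+1}{w}\big)^{2p}$, $Q_0=\frac{Q_1Ld2^p}{\eta}$. Then for all integers $t\ge0$ $$\|\bar{\mathbf x}(t)-\mathbf x_*\|\le\frac{Q_0\sqrt e\,a}{1-\beta}\big([t/2]+w-1\big)^{-p}+Y_1(t)+Y_2(t)+Y_3(t)$$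 (for $w=1$ and $t\le1$ the first term on the right is read as $+\infty$), where $$Y_1(t)=e^{-\sum_{s=0}^{t-1}\frac{\eta a}{(s+w)^p}}\|\mathbf x(0)-\mathbf x_*\|,\qquad Y_2(t)=\frac{\eta\,Q_0}{1-\beta}\,e^{-\frac{\eta a}{2}\frac{t}{(t+w)^p}}\sum_{s=1}^{[t/2]-1}\frac{a^2}{(w+s)^{2p}},$$ $$Y_3(t)=\frac{aLR_0}{(1-\beta)w^p}\bigg(\frac{e^{-\frac{\eta a}{2}\frac{t-1}{(t+w)^p}}}{1-\sqrt\beta}+\frac{\sqrt\beta^{\,[(t-1)/2]}}{1-\sqrt\beta}\bigg);$$ here $[z]$ is the largest integer $\le z$, the sum in $Y_2$ is zero for $t\le3$, and for $t=0$, $\beta=0$ the undefined term $\sqrt\beta^{\,[(t-1)/2]}$ is read as $0$. For every $N>0$ there is $C_N>0$, independent of $t$, with $Y_1(t)+Y_2(t)+Y_3(t)\le C_Nt^{-N}$ for all $t\ge1$. Consequently $\|\bar{\mathbf x}(t)-\mathbf x_*\|=O(t^{-p})$ as $t\to\infty$. -/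

import Mathlib

noncomputable section

namespace DGD

/-- The total cost `f = (1/m) ∑ i, f i`. -/
def totalCost {m n : ℕ} (f : Fin m → EuclideanSpace ℝ (Fin n) → ℝ) :
    EuclideanSpace ℝ (Fin n) → ℝ :=
  fun x => (1 / (m : ℝ)) * ∑ i, f i x

/-- `g` is differentiable with `K`-Lipschitz gradient. -/
def IsLSmooth {n : ℕ} (K : ℝ) (g : EuclideanSpace ℝ (Fin n) → ℝ) : Prop :=
  Differentiable ℝ g ∧ ∀ x y, ‖gradient g y - gradient g x‖ ≤ K * ‖y - x‖

/-- `μ`-strong convexity in its first-order form (used for differentiable `g`). -/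
def IsStronglyConvex {n : ℕ} (μ : ℝ) (g : EuclideanSpace ℝ (Fin n) → ℝ) : Prop :=
  ∀ x y, g x + inner ℝ (y - x) (gradient g x) + μ / 2 * ‖y - x‖ ^ 2 ≤ g y

/-- `W` is a doubly stochastic mixing matrix (nonnegative entries, unit row and column sums)
with positive diagonal, whose off-diagonal support is the edge set of the graph `G`. -/
def IsMixingMatrix {m : ℕ} (G : SimpleGraph (Fin m)) (W : Matrix (Fin m) (Fin m) ℝ) : Prop :=
  W ∈ doublyStochastic ℝ (Fin m) ∧
    (∀ i j, i ≠ j → (W i j ≠ 0 ↔ G.Adj i j)) ∧ ∀ i, 0 < W i i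

/-- The spectral norm (operator norm for Euclidean norms) of `W - (1/m) 𝟏 𝟏ᵀ`. -/
def beta {m : ℕ} (W : Matrix (Fin m) (Fin m) ℝ) : ℝ :=
  ‖Matrix.toEuclideanCLM (n := Fin m) (𝕜 := ℝ) (W - Matrix.of fun _ _ => 1 / (m : ℝ))‖

/-- The stepsize `α(t) = a / (t + w)^p`. -/
def stepsize (a w p : ℝ) (t : ℕ) : ℝ := a / ((t : ℝ) + w) ^ p

/-- The iterates of decentralized gradient descent started at `x₀`:
`x_i(t+1) = ∑ j, w_ij x_j(t) - α(t) ∇f_i(x_i(t))`. -/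
def iterate {m n : ℕ} (f : Fin m → EuclideanSpace ℝ (Fin n) → ℝ) (W : Matrix (Fin m) (Fin m) ℝ)
    (α : ℕ → ℝ) (x₀ : Fin m → EuclideanSpace ℝ (Fin n)) :
    ℕ → Fin m → EuclideanSpace ℝ (Fin n)
  | 0 => x₀
  | t + 1 => fun i =>
      (∑ j, W i j • iterate f W α x₀ t j) - α t • gradient (f i) (iterate f W α x₀ t i)

/-- The `l₂` norm `‖X‖ = (∑ i, ‖X i‖²)^(1/2)` of a stacked vector. -/
def stackNorm {m n : ℕ} (X : Fin m → EuclideanSpace ℝ (Fin n)) : ℝ :=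
  √(∑ i, ‖X i‖ ^ 2)

/-- The average `(1/m) ∑ k, X k`. -/
def average {m n : ℕ} (X : Fin m → EuclideanSpace ℝ (Fin n)) : EuclideanSpace ℝ (Fin n) :=
  (1 / (m : ℝ)) • ∑ k, X k

/-- `‖𝐱̄ - 𝐱⋆‖`, where `𝐱̄` and `𝐱⋆` are the stacked constant vectors. -/
def optError {m n : ℕ} (X : Fin m → EuclideanSpace ℝ (Fin n)) (xs : EuclideanSpace ℝ (Fin n)) :
    ℝ :=
  stackNorm fun _ : Fin m => average X - xs

/-- The consensus error `‖𝐱 - 𝐱̄‖`. -/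
def consError {m n : ℕ} (X : Fin m → EuclideanSpace ℝ (Fin n)) : ℝ :=
  stackNorm fun i => X i - average X

/-- `‖𝐱 - 𝐱⋆‖`. -/
def totalError {m n : ℕ} (X : Fin m → EuclideanSpace ℝ (Fin n)) (xs : EuclideanSpace ℝ (Fin n)) :
    ℝ :=
  stackNorm fun i => X i - xs

/-- `R` bounds `‖𝐱̄(t) - 𝐱⋆‖` and `‖𝐱(t) - 𝐱̄(t)‖` uniformly in `t`. -/
def IsUniformBound {m n : ℕ} (x : ℕ → Fin m → EuclideanSpace ℝ (Fin n))
    (xs : EuclideanSpace ℝ (Fin n)) (R : ℝ) : Prop :=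
  ∀ t, optError (x t) xs ≤ R ∧ consError (x t) ≤ R

/-- `D = max_i ‖∇f_i(x⋆)‖` (a maximum over a finite index set). -/
def gradMax {m n : ℕ} (f : Fin m → EuclideanSpace ℝ (Fin n) → ℝ)
    (xs : EuclideanSpace ℝ (Fin n)) : ℝ :=
  ⨆ i, ‖gradient (f i) xs‖

/-- `η = μ L / (μ + L)`. -/
def eta (μ L : ℝ) : ℝ := μ * L / (μ + L)

/-- `d = 2 L R + √m D`. -/
def dConst (m : ℕ) (L R D : ℝ) : ℝ := 2 * L * R + √(m : ℝ) * D

/-- `R₀ = c₀ + d α(0) / (1 - β)`, where `c₀` is the initial consensus error. -/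
def R0 (c₀ d α₀ β : ℝ) : ℝ := c₀ + d * α₀ / (1 - β)

/-- `Q₁ = ((w + 1) / w)^(2p)`. -/
def Q1 (w p : ℝ) : ℝ := ((w + 1) / w) ^ (2 * p)

/-- `Q₀ = Q₁ L d 2^p / η`. -/
def Q0 (w p L d η : ℝ) : ℝ := Q1 w p * L * d * 2 ^ p / η

/-- `Y₁(t)`; `e₀` is the initial error `‖𝐱(0) - 𝐱⋆‖`. -/
def Y1 (a w p η e₀ : ℝ) (t : ℕ) : ℝ :=
  Real.exp (-∑ s ∈ Finset.range t, η * a / ((s : ℝ) + w) ^ p) * e₀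

/-- `Y₂(t)`; the sum over `1 ≤ s ≤ [t/2] - 1` is empty for `t ≤ 3`. -/
def Y2 (a w p η β q₀ : ℝ) (t : ℕ) : ℝ :=
  η * q₀ / (1 - β) * Real.exp (-(η * a / 2) * ((t : ℝ) / ((t : ℝ) + w) ^ p)) *
    ∑ s ∈ Finset.Icc 1 (t / 2 - 1), a ^ 2 / (w + (s : ℝ)) ^ (2 * p)

/-- `Y₃(t)`. -/
def Y3 (a w p η β L r₀ : ℝ) (t : ℕ) : ℝ :=
  a * L * r₀ / ((1 - β) * w ^ p) *
    (Real.exp (-(η * a / 2) * (((t : ℝ) - 1) / ((t : ℝ) + w) ^ p)) / (1 - √β) +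
      √β ^ ⌊((t : ℝ) - 1) / 2⌋ / (1 - √β))

end DGD

end

/-! Let A(t) be the stacked distance from the average to the minimizer and B(t) the consensus error.
One iteration couples them linearly. The average makes a gradient step for the total cost, which
contracts by strong convexity, up to an error from evaluating the gradients at different points:
A(t+1) ≤ (1 - ηα)A + αLB (`optError_step_le`). Mixing contracts the deviations by β, and β < 1 by
connectivity and the positive diagonal (`IsMixingMatrix.beta_lt_one`): B(t+1) ≤ βB + α(L(A + B) + √m
D) (`consError_step_le`, `stackNorm_gradient_le`).

The bound on α(0) makes a box of values (A, B) invariant from time 1 on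
(`exists_bound_of_coupled_recursion`). With both errors at most R, the gradient term is at most d
and the recursion for B decouples: B(t) is of order α(t/2) plus a geometric term
(`le_half_of_geometric_recursion`).

Inserting this into the unrolled recursion for A leaves propagators summed against α(s)² and against
√β^s. Both sums are cut near t/2 (`optimality_estimate`). For early s the propagator is at most
exp(-const · t^(1-p)), which beats every power since p < 1. For late s, propagators weighted by ηα
telescope to at most 1, leaving one stepsize of order t^(-p); the other sum is a geometric tail. -/

namespace DGD

/-! ### Smooth and strongly convex functions. -/

section Smooth

variable {m n : ℕ}

/-- The descent lemma: a function with Lipschitz gradient lies below its quadratic models. -/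
theorem IsLSmooth.le_quadratic {K : ℝ} {g : EuclideanSpace ℝ (Fin n) → ℝ}
    (hg : IsLSmooth K g) (u z : EuclideanSpace ℝ (Fin n)) :
    g z ≤ g u + inner ℝ (z - u) (gradient g u) + K / 2 * ‖z - u‖ ^ 2 := by
  obtain ⟨v, rfl⟩ : ∃ v, z = u + v := ⟨z - u, by abel⟩
  rw [add_sub_cancel_left]
  -- φ is the gap to the quadratic model along the segment; the Lipschitz bound makes its derivative
  -- nonpositive, so φ(1) ≤ φ(0).
  set φ : ℝ → ℝ := fun t =>
    g (u + t • v) - t * inner ℝ v (gradient g u) - K / 2 * t ^ 2 * ‖v‖ ^ 2 with hφ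
  have hd : ∀ t, HasDerivAt φ (inner ℝ (gradient g (u + t • v)) v - inner ℝ v (gradient g u)
      - K * t * ‖v‖ ^ 2) t := by
    intro t
    have h1 : HasDerivAt (fun t : ℝ => u + t • v) v t := by
      simpa using ((hasDerivAt_id t).smul_const v).const_add u
    have h2 := (hg.1 (u + t • v)).hasFDerivAt.comp_hasDerivAt t h1
    rw [← inner_gradient_left] at h2
    have h3 := (hasDerivAt_id t).mul_const (inner ℝ v (gradient g u))
    have h4 := (((hasDerivAt_id t).pow 2).const_mul (K / 2)).mul_const (‖v‖ ^ 2)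
    refine ((h2.sub h3).sub h4).congr_deriv ?_
    simp only [id_eq, one_mul, mul_one, Nat.cast_ofNat, Nat.add_one_sub_one, pow_one]
    ring
  have hanti : AntitoneOn φ (Set.Icc 0 1) := by
    refine antitoneOn_of_deriv_nonpos (convex_Icc 0 1)
      (fun t _ => (hd t).continuousAt.continuousWithinAt)
      (fun t _ => (hd t).differentiableAt.differentiableWithinAt) ?_
    intro t ht
    rw [interior_Icc] at ht
    rw [(hd t).deriv, real_inner_comm (gradient g u) v, ← inner_sub_left]
    have h1 := hg.2 u (u + t • v)
    rw [add_sub_cancel_left, norm_smul, Real.norm_of_nonneg ht.1.le] at h1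
    have h2 := real_inner_le_norm (gradient g (u + t • v) - gradient g u) v
    nlinarith [mul_le_mul_of_nonneg_right h1 (norm_nonneg v)]
  have h := hanti (Set.left_mem_Icc.2 zero_le_one) (Set.right_mem_Icc.2 zero_le_one) zero_le_one
  simp only [hφ, one_smul, zero_smul, add_zero] at h
  linarith

theorem IsLSmooth.mono {K K' : ℝ} {g : EuclideanSpace ℝ (Fin n) → ℝ} (hg : IsLSmooth K g)
    (h : K ≤ K') : IsLSmooth K' g :=
  ⟨hg.1, fun x y => (hg.2 x y).trans (by gcongr)⟩

theorem gradient_totalCost {f : Fin m → EuclideanSpace ℝ (Fin n) → ℝ}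
    (hf : ∀ i, Differentiable ℝ (f i)) (x : EuclideanSpace ℝ (Fin n)) :
    gradient (totalCost f) x = (1 / (m : ℝ)) • ∑ i, gradient (f i) x := by
  apply HasGradientAt.gradient
  rw [hasGradientAt_iff_hasFDerivAt, map_smul, map_sum]
  have h : HasFDerivAt (fun y => ∑ i, f i y)
      (∑ i, (InnerProductSpace.toDual ℝ _) (gradient (f i) x)) x :=
    HasFDerivAt.fun_sum fun i _ =>
      hasGradientAt_iff_hasFDerivAt.1 (hf i x).hasGradientAt
  exact h.const_mul _

theorem differentiable_totalCost {f : Fin m → EuclideanSpace ℝ (Fin n) → ℝ}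
    (hf : ∀ i, Differentiable ℝ (f i)) : Differentiable ℝ (totalCost f) := by
  unfold totalCost
  exact (Differentiable.fun_sum fun i _ => hf i).const_mul _

theorem isLSmooth_totalCost [NeZero m] {K : ℝ} {f : Fin m → EuclideanSpace ℝ (Fin n) → ℝ}
    (hf : ∀ i, IsLSmooth K (f i)) : IsLSmooth K (totalCost f) := by
  refine ⟨differentiable_totalCost fun i => (hf i).1, fun x y => ?_⟩
  have hm : (0 : ℝ) < m := by exact_mod_cast NeZero.pos m
  rw [gradient_totalCost (fun i => (hf i).1), gradient_totalCost (fun i => (hf i).1), ← smul_sub,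
    ← Finset.sum_sub_distrib, norm_smul, Real.norm_of_nonneg (by positivity)]
  calc 1 / (m : ℝ) * ‖∑ i, (gradient (f i) y - gradient (f i) x)‖
      ≤ 1 / (m : ℝ) * ∑ _i : Fin m, K * ‖y - x‖ := by
        gcongr
        exact norm_sum_le_of_le _ fun i _ => (hf i).2 x y
    _ = K * ‖y - x‖ := by
        rw [Finset.sum_const, Finset.card_univ, Fintype.card_fin, nsmul_eq_mul]
        field_simp

variable {μ : ℝ} {g : EuclideanSpace ℝ (Fin n) → ℝ}

theorem IsStronglyConvex.mul_sq_norm_le_inner (hc : IsStronglyConvex μ g)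
    {xs : EuclideanSpace ℝ (Fin n)} (h0 : gradient g xs = 0) (x : EuclideanSpace ℝ (Fin n)) :
    μ * ‖x - xs‖ ^ 2 ≤ inner ℝ (x - xs) (gradient g x) := by
  have h1 := hc x xs
  have h2 := hc xs x
  rw [h0, inner_zero_right] at h2
  rw [← neg_sub x xs, inner_neg_left, norm_neg] at h1
  linarith

/-- The strengthened monotonicity of the gradient of a smooth strongly convex function. -/
theorem IsStronglyConvex.mul_sq_norm_add_sq_norm_le_inner {L : ℝ} (hc : IsStronglyConvex μ g)
    (hg : IsLSmooth L g) (hL : 0 ≤ L) {xs : EuclideanSpace ℝ (Fin n)} (hμ : 0 ≤ μ)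
    (h0 : gradient g xs = 0) (x : EuclideanSpace ℝ (Fin n)) :
    L * μ * ‖x - xs‖ ^ 2 + ‖gradient g x‖ ^ 2 ≤
      (L + μ) * inner ℝ (x - xs) (gradient g x) := by
  have hmon := hc.mul_sq_norm_le_inner h0 x
  -- The main argument divides by L - μ. If L ≤ μ, then ‖∇g x‖ ≤ μ‖x - xs‖ and plain monotonicity
  -- suffices.
  rcases le_or_gt L μ with hle | hlt
  · have h1 := hg.2 xs x
    rw [h0, sub_zero] at h1
    have h2 : ‖gradient g x‖ ^ 2 ≤ (μ * ‖x - xs‖) ^ 2 := by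
      gcongr
      exact h1.trans (by gcongr)
    nlinarith [mul_le_mul_of_nonneg_left hmon (add_nonneg hL hμ)]
  · set r := x - xs with hr
    set v := gradient g x with hv
    -- At each of the points x + s and xs - s, a strong convexity lower bound from one base point
    -- meets a descent upper bound from the other; in the sum all values of g cancel.
    have key : ∀ s, μ * ‖r + s‖ ^ 2 - inner ℝ r v ≤ 2 * inner ℝ s v + L * ‖s‖ ^ 2 := by
      intro s
      have h1 := hc xs (x + s)
      have h2 := hg.le_quadratic x (x + s)
      have h3 := hc x (xs - s)
      have h4 := hg.le_quadratic xs (xs - s)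
      rw [h0, inner_zero_right] at h1 h4
      rw [add_sub_cancel_left] at h2
      have e1 : x + s - xs = r + s := by rw [hr]; abel
      have e2 : xs - s - x = -(r + s) := by rw [hr]; abel
      have e3 : xs - s - xs = -s := by abel
      rw [e1] at h1
      rw [e2, norm_neg, inner_neg_left, inner_add_left] at h3
      rw [e3, norm_neg] at h4
      linarith
    clear_value r v
    have hpos : 0 < L - μ := sub_pos.2 hlt
    -- This s minimizes 2⟨s, v⟩ + L‖s‖² - μ‖r + s‖², so it gives the sharpest instance.
    have h := key (-(1 / (L - μ)) • (v - μ • r))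
    have e : ∀ c : ℝ, ∀ q : EuclideanSpace ℝ (Fin n), ‖r + c • q‖ ^ 2 =
        ‖r‖ ^ 2 + 2 * c * inner ℝ r q + c ^ 2 * ‖q‖ ^ 2 := by
      intro c q
      rw [norm_add_sq_real, inner_smul_right, norm_smul, mul_pow, Real.norm_eq_abs, sq_abs]
      ring
    have e' : ‖v - μ • r‖ ^ 2 = ‖v‖ ^ 2 - 2 * μ * inner ℝ r v + μ ^ 2 * ‖r‖ ^ 2 := by
      rw [norm_sub_sq_real, inner_smul_right, norm_smul, mul_pow, Real.norm_eq_abs, sq_abs,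
        real_inner_comm]
      ring
    rw [e, norm_smul, mul_pow, Real.norm_eq_abs, sq_abs, inner_smul_left, e', inner_sub_left,
      inner_sub_right, inner_smul_left, inner_smul_right, real_inner_self_eq_norm_sq,
      real_inner_self_eq_norm_sq] at h
    simp only [conj_trivial] at h
    set I : ℝ := inner ℝ r v
    have hmul := mul_le_mul_of_nonneg_left h hpos.le
    have hcl : (L - μ) * (1 / (L - μ)) = 1 := by field_simp
    set c := 1 / (L - μ)
    have hL' : L = (L - μ) + μ := by ring
    set k := L - μ
    rw [hL'] at hmul ⊢
    have hc2 : k * c ^ 2 = c := by rw [pow_two, ← mul_assoc, hcl, one_mul]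
    have hc3 : k * k * c ^ 2 = 1 := by rw [mul_assoc, hc2, hcl]
    have : k * (μ * (‖r‖ ^ 2 + 2 * -c * (I - μ * ‖r‖ ^ 2) +
        (-c) ^ 2 * (‖v‖ ^ 2 - 2 * μ * I + μ ^ 2 * ‖r‖ ^ 2)) - I) -
        k * (2 * (-c * (‖v‖ ^ 2 - μ * I)) +
        (k + μ) * ((-c) ^ 2 * (‖v‖ ^ 2 - 2 * μ * I + μ ^ 2 * ‖r‖ ^ 2))) =
        k * μ * ‖r‖ ^ 2 - k * I - 2 * μ * (k * c) * (I - μ * ‖r‖ ^ 2)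
          + 2 * (k * c) * (‖v‖ ^ 2 - μ * I)
          - (k * k * c ^ 2) * (‖v‖ ^ 2 - 2 * μ * I + μ ^ 2 * ‖r‖ ^ 2) := by ring
    rw [hcl, hc3] at this
    nlinarith

/-- A gradient step with stepsize at most `2 / (μ + L)` contracts towards the minimizer. -/
theorem IsStronglyConvex.norm_gradient_step_le {L α : ℝ} (hc : IsStronglyConvex μ g)
    (hg : IsLSmooth L g) (hL : 0 < L) {xs : EuclideanSpace ℝ (Fin n)} (hμ : 0 < μ)
    (h0 : gradient g xs = 0) (hα : 0 ≤ α) (hα' : α ≤ 2 / (μ + L)) (hηα : eta μ L * α ≤ 1)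
    (x : EuclideanSpace ℝ (Fin n)) :
    ‖x - α • gradient g x - xs‖ ≤ (1 - eta μ L * α) * ‖x - xs‖ := by
  refine le_of_sq_le_sq ?_ (mul_nonneg (by linarith) (norm_nonneg _))
  have h := hc.mul_sq_norm_add_sq_norm_le_inner hg hL.le hμ.le h0 x
  have e : x - α • gradient g x - xs = (x - xs) - α • gradient g x := by abel
  rw [e, norm_sub_sq_real, inner_smul_right, norm_smul, mul_pow, mul_pow, Real.norm_eq_abs, sq_abs]
  set v := gradient g x
  set r := x - xs
  have hs : 0 < μ + L := by linarith
  have hη : eta μ L * (μ + L) = μ * L := by unfold eta; field_simp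
  rw [le_div_iff₀ hs] at hα'
  have h' : eta μ L * ‖r‖ ^ 2 + ‖v‖ ^ 2 / (μ + L) ≤ inner ℝ r v := by
    rw [← mul_le_mul_iff_of_pos_left hs]
    have : (μ + L) * (eta μ L * ‖r‖ ^ 2 + ‖v‖ ^ 2 / (μ + L)) =
      (eta μ L * (μ + L)) * ‖r‖ ^ 2 + ‖v‖ ^ 2 := by field_simp
    rw [this, hη]
    linarith
  -- The condition α ≤ 2/(μ + L) lets the cross term absorb α²‖v‖². What is left, (1 - 2ηα)‖r‖², is
  -- at most (1 - ηα)²‖r‖².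
  have h2 : α * ‖v‖ ^ 2 ≤ 2 * (‖v‖ ^ 2 / (μ + L)) := by
    rw [← mul_div_assoc, le_div_iff₀ hs]
    nlinarith [sq_nonneg ‖v‖]
  have h3 := mul_le_mul_of_nonneg_left h' hα
  have h4 := mul_le_mul_of_nonneg_left h2 hα
  nlinarith [mul_nonneg (sq_nonneg (eta μ L * α)) (sq_nonneg ‖r‖)]

/-- The quadratic lower bound at the origin makes g coercive, and a continuous coercive function
attains its minimum. -/
theorem IsStronglyConvex.exists_isMinOn (hc : IsStronglyConvex μ g) (hμ : 0 < μ)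
    (hg : Differentiable ℝ g) : ∃ xs, IsMinOn g Set.univ xs := by
  have hcont : Continuous g := hg.continuous
  have hlim : Filter.Tendsto g (Filter.cocompact _) Filter.atTop := by
    have hnorm := tendsto_norm_cocompact_atTop (E := EuclideanSpace ℝ (Fin n))
    have hquad : Filter.Tendsto (fun s : ℝ => g 0 + s * (μ / 2 * s - ‖gradient g 0‖))
        Filter.atTop Filter.atTop :=
      Filter.tendsto_atTop_add_const_left _ _ (Filter.tendsto_id.atTop_mul_atTop₀
        (Filter.tendsto_atTop_add_const_right _ _
          (Filter.tendsto_id.const_mul_atTop (by positivity))))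
    refine Filter.tendsto_atTop_mono (fun y => ?_) (hquad.comp hnorm)
    have h := hc 0 y
    have h2 := neg_le_of_abs_le (abs_real_inner_le_norm y (gradient g 0))
    rw [sub_zero] at h
    simp only [Function.comp]
    nlinarith
  obtain ⟨xs, h⟩ := hcont.exists_forall_le hlim
  exact ⟨xs, fun y _ => h y⟩

theorem gradient_eq_zero_of_isMinOn {xs : EuclideanSpace ℝ (Fin n)}
    (h : IsMinOn g Set.univ xs) : gradient g xs = 0 := by
  have : IsLocalMin g xs := h.isLocalMin Filter.univ_mem
  unfold gradient
  rw [this.fderiv_eq_zero, map_zero]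

theorem IsStronglyConvex.eq_of_isMinOn (hc : IsStronglyConvex μ g) (hμ : 0 < μ)
    {x y : EuclideanSpace ℝ (Fin n)} (hx : IsMinOn g Set.univ x) (hy : IsMinOn g Set.univ y) :
    x = y := by
  have h := hc y x
  rw [gradient_eq_zero_of_isMinOn hy, inner_zero_right] at h
  have h2 : g x ≤ g y := hx (Set.mem_univ y)
  have h3 : ‖x - y‖ ^ 2 ≤ 0 := by nlinarith
  have h4 : ‖x - y‖ = 0 := by
    have := sq_nonneg ‖x - y‖
    exact pow_eq_zero_iff two_ne_zero |>.1 (le_antisymm h3 this)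
  exact sub_eq_zero.1 (norm_eq_zero.1 h4)

end Smooth

/-! ### Norms and averages of stacked vectors. -/

section Stack

variable {m n : ℕ}

theorem stackNorm_eq_norm_toLp (X : Fin m → EuclideanSpace ℝ (Fin n)) :
    stackNorm X = ‖WithLp.toLp 2 X‖ := by
  rw [PiLp.norm_eq_of_L2, stackNorm]

theorem stackNorm_nonneg (X : Fin m → EuclideanSpace ℝ (Fin n)) : 0 ≤ stackNorm X :=
  Real.sqrt_nonneg _

theorem sq_stackNorm (X : Fin m → EuclideanSpace ℝ (Fin n)) :
    stackNorm X ^ 2 = ∑ i, ‖X i‖ ^ 2 :=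
  Real.sq_sqrt (Finset.sum_nonneg fun _ _ => sq_nonneg _)

theorem stackNorm_add_le (X Y : Fin m → EuclideanSpace ℝ (Fin n)) :
    stackNorm (fun i => X i + Y i) ≤ stackNorm X + stackNorm Y := by
  simp only [stackNorm_eq_norm_toLp]
  exact norm_add_le (WithLp.toLp 2 X) (WithLp.toLp 2 Y)

theorem stackNorm_sub_le (X Y : Fin m → EuclideanSpace ℝ (Fin n)) :
    stackNorm (fun i => X i - Y i) ≤ stackNorm X + stackNorm Y := by
  simp only [stackNorm_eq_norm_toLp]
  exact norm_sub_le (WithLp.toLp 2 X) (WithLp.toLp 2 Y)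

theorem stackNorm_smul {c : ℝ} (hc : 0 ≤ c) (X : Fin m → EuclideanSpace ℝ (Fin n)) :
    stackNorm (fun i => c • X i) = c * stackNorm X := by
  simp only [stackNorm_eq_norm_toLp]
  rw [← abs_of_nonneg hc, ← Real.norm_eq_abs, ← norm_smul, Real.norm_eq_abs, abs_of_nonneg hc]
  rfl

theorem stackNorm_le_mul {X Y : Fin m → EuclideanSpace ℝ (Fin n)} {c : ℝ} (hc : 0 ≤ c)
    (h : ∀ i, ‖X i‖ ≤ c * ‖Y i‖) : stackNorm X ≤ c * stackNorm Y := by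
  refine le_of_sq_le_sq ?_ (mul_nonneg hc (stackNorm_nonneg _))
  rw [mul_pow, sq_stackNorm, sq_stackNorm, Finset.mul_sum]
  refine Finset.sum_le_sum fun i _ => ?_
  rw [← mul_pow]
  gcongr
  exact h i

theorem stackNorm_const (v : EuclideanSpace ℝ (Fin n)) :
    stackNorm (fun _ : Fin m => v) = √(m : ℝ) * ‖v‖ := by
  rw [stackNorm, Finset.sum_const, Finset.card_univ, Fintype.card_fin, nsmul_eq_mul,
    Real.sqrt_mul (Nat.cast_nonneg m), Real.sqrt_sq (norm_nonneg v)]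

theorem stackNorm_le_sqrt_mul {X : Fin m → EuclideanSpace ℝ (Fin n)} {c : ℝ}
    (h : ∀ i, ‖X i‖ ≤ c) : stackNorm X ≤ √(m : ℝ) * c := by
  rcases Nat.eq_zero_or_pos m with rfl | hm
  · simp [stackNorm]
  · have hc : 0 ≤ c := (norm_nonneg _).trans (h ⟨0, hm⟩)
    rw [← Real.sqrt_sq hc, ← Real.sqrt_mul (Nat.cast_nonneg m), stackNorm]
    refine Real.sqrt_le_sqrt ?_
    calc ∑ i, ‖X i‖ ^ 2 ≤ ∑ _i : Fin m, c ^ 2 := by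
          gcongr with i
          exact h i
      _ = m * c ^ 2 := by simp

theorem smul_average [NeZero m] (X : Fin m → EuclideanSpace ℝ (Fin n)) :
    (m : ℝ) • average X = ∑ i, X i := by
  have hm : (m : ℝ) ≠ 0 := by exact_mod_cast NeZero.ne m
  rw [average, smul_smul, mul_one_div_cancel hm, one_smul]

theorem sum_sub_average [NeZero m] (X : Fin m → EuclideanSpace ℝ (Fin n)) :
    ∑ i, (X i - average X) = 0 := by
  rw [Finset.sum_sub_distrib, Finset.sum_const, Finset.card_univ, Fintype.card_fin,
    ← Nat.cast_smul_eq_nsmul ℝ, smul_average, sub_self]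

/-- The variance decomposition of a stacked vector. -/
theorem sq_consError_add [NeZero m] (X : Fin m → EuclideanSpace ℝ (Fin n)) :
    consError X ^ 2 + m * ‖average X‖ ^ 2 = stackNorm X ^ 2 := by
  rw [consError, sq_stackNorm, sq_stackNorm]
  have h : ∀ i, ‖X i - average X‖ ^ 2 =
      ‖X i‖ ^ 2 - 2 * inner ℝ (X i - average X) (average X) - ‖average X‖ ^ 2 := by
    intro i
    rw [norm_sub_sq_real, inner_sub_left, real_inner_self_eq_norm_sq]
    ring
  simp only [h]
  rw [Finset.sum_sub_distrib, Finset.sum_sub_distrib, ← Finset.mul_sum, ← sum_inner,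
    sum_sub_average, inner_zero_left]
  simp

theorem consError_le_stackNorm [NeZero m] (X : Fin m → EuclideanSpace ℝ (Fin n)) :
    consError X ≤ stackNorm X := by
  refine le_of_sq_le_sq ?_ (stackNorm_nonneg _)
  rw [← sq_consError_add]
  have : (0 : ℝ) ≤ m * ‖average X‖ ^ 2 := by positivity
  linarith

theorem sqrt_mul_norm_average_le [NeZero m] (X : Fin m → EuclideanSpace ℝ (Fin n)) :
    √(m : ℝ) * ‖average X‖ ≤ stackNorm X := by
  refine le_of_sq_le_sq ?_ (stackNorm_nonneg _)
  rw [← sq_consError_add, mul_pow, Real.sq_sqrt (Nat.cast_nonneg m)]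
  linarith [sq_nonneg (consError X)]

theorem optError_eq (X : Fin m → EuclideanSpace ℝ (Fin n)) (xs : EuclideanSpace ℝ (Fin n)) :
    optError X xs = √(m : ℝ) * ‖average X - xs‖ := stackNorm_const _

theorem optError_nonneg (X : Fin m → EuclideanSpace ℝ (Fin n)) (xs : EuclideanSpace ℝ (Fin n)) :
    0 ≤ optError X xs := stackNorm_nonneg _

theorem consError_nonneg (X : Fin m → EuclideanSpace ℝ (Fin n)) : 0 ≤ consError X :=
  stackNorm_nonneg _

theorem totalError_nonneg (X : Fin m → EuclideanSpace ℝ (Fin n))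
    (xs : EuclideanSpace ℝ (Fin n)) : 0 ≤ totalError X xs := stackNorm_nonneg _

theorem optError_le_totalError [NeZero m] (X : Fin m → EuclideanSpace ℝ (Fin n))
    (xs : EuclideanSpace ℝ (Fin n)) : optError X xs ≤ totalError X xs := by
  have h : average X - xs = average fun i => X i - xs := by
    have hm : (m : ℝ) ≠ 0 := by exact_mod_cast NeZero.ne m
    rw [average, average, Finset.sum_sub_distrib, smul_sub, Finset.sum_const, Finset.card_univ,
      Fintype.card_fin, ← Nat.cast_smul_eq_nsmul ℝ, smul_smul, one_div_mul_cancel hm, one_smul]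
  rw [optError_eq, h]
  exact sqrt_mul_norm_average_le _

theorem totalError_le (X : Fin m → EuclideanSpace ℝ (Fin n)) (xs : EuclideanSpace ℝ (Fin n)) :
    totalError X xs ≤ optError X xs + consError X := by
  have h := stackNorm_add_le (fun _ : Fin m => average X - xs) (fun i => X i - average X)
  simp only [sub_add_sub_cancel'] at h
  exact h

/-- A matrix acting blockwise is bounded by its spectral norm. -/
theorem stackNorm_sum_smul_le (M : Matrix (Fin m) (Fin m) ℝ)
    (X : Fin m → EuclideanSpace ℝ (Fin n)) :
    stackNorm (fun i => ∑ j, M i j • X j) ≤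
      ‖Matrix.toEuclideanCLM (n := Fin m) (𝕜 := ℝ) M‖ * stackNorm X := by
  set T := Matrix.toEuclideanCLM (n := Fin m) (𝕜 := ℝ) M with hT
  refine le_of_sq_le_sq ?_ (mul_nonneg (norm_nonneg _) (stackNorm_nonneg _))
  rw [mul_pow, sq_stackNorm, sq_stackNorm]
  simp only [EuclideanSpace.norm_sq_eq]
  -- For each fixed coordinate k, the numbers X j k form a vector of ℝ^m on which the matrix acts in
  -- the usual way.
  rw [Finset.sum_comm, Finset.sum_comm (f := fun i k => ‖X i k‖ ^ 2), Finset.mul_sum]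
  refine Finset.sum_le_sum fun k _ => ?_
  have h := T.le_opNorm (WithLp.toLp 2 fun j => X j k)
  have h2 := pow_le_pow_left₀ (norm_nonneg _) h 2
  rw [mul_pow, EuclideanSpace.norm_sq_eq, EuclideanSpace.norm_sq_eq, hT,
    Matrix.toEuclideanCLM_toLp] at h2
  simpa [Matrix.mulVec, dotProduct] using h2

end Stack

/-! ### Spectral gap of the mixing matrix. -/

section Mixing

variable {m n : ℕ} {W : Matrix (Fin m) (Fin m) ℝ}

/-- Row i of W is a probability vector, and the inner sum on the right is the variance of v under
it. Unit column sums turn the total of the second moments into ∑ v j ^ 2. -/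
theorem sum_sub_sum_sq_eq (hW : W ∈ doublyStochastic ℝ (Fin m)) (v : Fin m → ℝ) :
    ∑ j, v j ^ 2 - ∑ i, (∑ j, W i j * v j) ^ 2 =
      ∑ i, ∑ j, W i j * (v j - ∑ k, W i k * v k) ^ 2 := by
  have h : ∀ i, ∑ j, W i j * (v j - ∑ k, W i k * v k) ^ 2 =
      ∑ j, W i j * v j ^ 2 - (∑ j, W i j * v j) ^ 2 := by
    intro i
    set s := ∑ k, W i k * v k with hs
    have : ∀ j, W i j * (v j - s) ^ 2 = W i j * v j ^ 2 - 2 * s * (W i j * v j) + s ^ 2 * W i j :=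
      fun j => by ring
    simp only [this]
    rw [Finset.sum_add_distrib, Finset.sum_sub_distrib, ← Finset.mul_sum, ← Finset.mul_sum,
      sum_row_of_mem_doublyStochastic hW, ← hs]
    ring
  simp only [h]
  rw [Finset.sum_sub_distrib, Finset.sum_comm (f := fun i j => W i j * v j ^ 2)]
  simp only [← Finset.sum_mul, sum_col_of_mem_doublyStochastic hW, one_mul]

/-- A mixing matrix strictly contracts nonzero mean-zero vectors. -/
theorem IsMixingMatrix.sum_sq_mulVec_lt {G : SimpleGraph (Fin m)} (hW : IsMixingMatrix G W)
    (hG : G.Connected) {v : Fin m → ℝ} (hv : v ≠ 0) (hsum : ∑ i, v i = 0) :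
    ∑ i, (∑ j, W i j * v j) ^ 2 < ∑ i, v i ^ 2 := by
  obtain ⟨hds, hadj, hdiag⟩ := hW
  by_contra! hle
  have hnn : ∀ i j, 0 ≤ W i j * (v j - ∑ k, W i k * v k) ^ 2 := fun i j =>
    mul_nonneg (nonneg_of_mem_doublyStochastic hds) (sq_nonneg _)
  have h0 : ∑ i, ∑ j, W i j * (v j - ∑ k, W i k * v k) ^ 2 = 0 := by
    refine le_antisymm ?_ (Finset.sum_nonneg fun i _ => Finset.sum_nonneg fun j _ => hnn i j)
    rw [← sum_sub_sum_sq_eq hds]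
    linarith
  have h1 : ∀ i j, W i j ≠ 0 → v j = ∑ k, W i k * v k := by
    intro i j hij
    have h2 := (Finset.sum_eq_zero_iff_of_nonneg fun i _ =>
      Finset.sum_nonneg fun j _ => hnn i j).1 h0 i (Finset.mem_univ i)
    have h3 := (Finset.sum_eq_zero_iff_of_nonneg fun j _ => hnn i j).1 h2 j (Finset.mem_univ j)
    have h4 := (mul_eq_zero.1 h3).resolve_left hij
    exact sub_eq_zero.1 (pow_eq_zero_iff two_ne_zero |>.1 h4)
  -- The positive diagonal identifies v i with the mean of row i, which the neighbours of i also
  -- equal.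
  have hedge : ∀ i j, G.Adj i j → v i = v j := fun i j hij =>
    (h1 i i (hdiag i).ne').trans (h1 i j ((hadj i j hij.ne).2 hij)).symm
  have hconst : ∀ i j, v i = v j := by
    intro i j
    obtain ⟨q⟩ := hG.preconnected i j
    induction q with
    | nil => rfl
    | cons h _ ih => exact (hedge _ _ h).trans ih
  apply hv
  funext i
  have : ∑ j, v j = m * v i := by
    rw [Finset.sum_congr rfl fun j _ => hconst j i]
    simp
  rw [hsum, eq_comm, mul_eq_zero] at this
  have hm : (m : ℝ) ≠ 0 := by
    exact_mod_cast (Fin.pos i).ne'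
  exact this.resolve_left hm

theorem beta_nonneg (W : Matrix (Fin m) (Fin m) ℝ) : 0 ≤ beta W := norm_nonneg _

/-- Subtracting the averaging matrix kills the mean of a vector, and W strictly shrinks the
mean-zero rest. The norm is attained on the compact unit sphere, so strict shrinking of each vector
gives a norm below 1. -/
theorem IsMixingMatrix.beta_lt_one {G : SimpleGraph (Fin m)} (hW : IsMixingMatrix G W)
    (hG : G.Connected) : beta W < 1 := by
  have := hG.nonempty
  have hm : (m : ℝ) ≠ 0 := by
    exact_mod_cast (Fin.pos (Classical.arbitrary (Fin m))).ne'
  set T := Matrix.toEuclideanCLM (n := Fin m) (𝕜 := ℝ)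
    (W - Matrix.of fun _ _ => 1 / (m : ℝ)) with hT
  have hlt : ∀ u : EuclideanSpace ℝ (Fin m), u ≠ 0 → ‖T u‖ < ‖u‖ := by
    intro u hu
    set c := (1 / (m : ℝ)) * ∑ i, u i with hc
    have hmc : m * c = ∑ i, u i := by rw [hc]; field_simp
    have hTu : ∀ i, T u i = ∑ j, W i j * (u j - c) := by
      intro i
      have : T u i = ∑ j, (W i j - 1 / (m : ℝ)) * u j := by
        rw [hT, Matrix.ofLp_toEuclideanCLM]
        simp [Matrix.mulVec, dotProduct]
      rw [this]
      simp only [sub_mul, mul_sub]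
      rw [Finset.sum_sub_distrib, Finset.sum_sub_distrib, ← Finset.mul_sum, ← Finset.sum_mul,
        sum_row_of_mem_doublyStochastic hW.1, one_mul]
    have hvar : ∑ i, (u i - c) ^ 2 + m * c ^ 2 = ∑ i, u i ^ 2 := by
      have : ∀ i, (u i - c) ^ 2 = u i ^ 2 - 2 * c * u i + c ^ 2 := fun i => by ring
      simp only [this]
      rw [Finset.sum_add_distrib, Finset.sum_sub_distrib, ← Finset.mul_sum, ← hmc]
      simp
      ring
    refine lt_of_pow_lt_pow_left₀ 2 (norm_nonneg _) ?_
    rw [EuclideanSpace.norm_sq_eq, EuclideanSpace.norm_sq_eq]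
    simp only [Real.norm_eq_abs, sq_abs, hTu]
    have hmc2 : 0 ≤ (m : ℝ) * c ^ 2 := by positivity
    by_cases hv : (fun i => u i - c) = 0
    · have h0 : ∀ j, u j - c = 0 := fun j => congrFun hv j
      have hpos : 0 < ‖u‖ ^ 2 := by positivity
      rw [EuclideanSpace.norm_sq_eq] at hpos
      simpa [h0] using hpos
    · have hs : ∑ i, (u i - c) = 0 := by
        rw [Finset.sum_sub_distrib, ← hmc]
        simp
      have := hW.sum_sq_mulVec_lt hG hv hs
      linarith
  obtain ⟨u, hu, hmax⟩ := (isCompact_sphere (0 : EuclideanSpace ℝ (Fin m)) 1).exists_isMaxOn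
    (NormedSpace.sphere_nonempty.2 zero_le_one) T.continuous.norm.continuousOn
  have hu1 : ‖u‖ = 1 := by simpa using hu
  have hTu : ‖T u‖ < 1 := hu1 ▸ hlt u (norm_ne_zero_iff.1 (by rw [hu1]; exact one_ne_zero))
  refine lt_of_le_of_lt (T.opNorm_le_bound (norm_nonneg (T u)) fun y => ?_) hTu
  by_cases hy : y = 0
  · simp [hy]
  · have hy' : ‖y‖ ≠ 0 := norm_ne_zero_iff.2 hy
    have := hmax (show ‖y‖⁻¹ • y ∈ Metric.sphere 0 1 by
      rw [mem_sphere_zero_iff_norm, norm_smul, norm_inv, norm_norm, inv_mul_cancel₀ hy'])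
    simp only [Set.mem_ofPred_eq, map_smul, norm_smul, norm_inv, norm_norm] at this
    rwa [inv_mul_le_iff₀ (by positivity), mul_comm] at this

end Mixing

/-! ### One iteration: the two coupled error inequalities. -/

section Step

variable {m n : ℕ} {W : Matrix (Fin m) (Fin m) ℝ} {f : Fin m → EuclideanSpace ℝ (Fin n) → ℝ}

theorem average_mix (hW : W ∈ doublyStochastic ℝ (Fin m))
    (X : Fin m → EuclideanSpace ℝ (Fin n)) :
    average (fun i => ∑ j, W i j • X j) = average X := by
  rw [average, average, Finset.sum_comm]
  simp only [← Finset.sum_smul, sum_col_of_mem_doublyStochastic hW, one_smul]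

theorem average_sub_smul (X Y : Fin m → EuclideanSpace ℝ (Fin n)) (c : ℝ) :
    average (fun i => X i - c • Y i) = average X - c • average Y := by
  simp only [average, Finset.sum_sub_distrib, smul_sub, ← Finset.smul_sum]
  rw [smul_comm]

theorem mix_sub_average [NeZero m] (hW : W ∈ doublyStochastic ℝ (Fin m))
    (X : Fin m → EuclideanSpace ℝ (Fin n)) (i : Fin m) :
    (∑ j, W i j • X j) - average X =
      ∑ j, (W - Matrix.of fun _ _ => 1 / (m : ℝ) : Matrix (Fin m) (Fin m) ℝ) i j • (X j - average X) := by
  simp only [Matrix.sub_apply, Matrix.of_apply, sub_smul, Finset.sum_sub_distrib]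
  rw [← Finset.smul_sum, sum_sub_average, smul_zero, sub_zero]
  simp only [smul_sub, Finset.sum_sub_distrib]
  rw [← Finset.sum_smul, sum_row_of_mem_doublyStochastic hW, one_smul]

/-- One step of decentralized gradient descent with stepsize `α`. -/
noncomputable def step (f : Fin m → EuclideanSpace ℝ (Fin n) → ℝ) (W : Matrix (Fin m) (Fin m) ℝ) (α : ℝ)
    (X : Fin m → EuclideanSpace ℝ (Fin n)) : Fin m → EuclideanSpace ℝ (Fin n) :=
  fun i => (∑ j, W i j • X j) - α • gradient (f i) (X i)

theorem average_step (hW : W ∈ doublyStochastic ℝ (Fin m)) (α : ℝ)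
    (X : Fin m → EuclideanSpace ℝ (Fin n)) :
    average (step f W α X) = average X - α • average fun i => gradient (f i) (X i) := by
  have h := average_sub_smul (fun i => ∑ j, W i j • X j) (fun i => gradient (f i) (X i)) α
  rw [average_mix hW] at h
  exact h

/-- The new deviations are W - (1/m)𝟏𝟏ᵀ applied to the old ones, minus α times the centred
gradients; centring does not increase the stacked norm. -/
theorem consError_step_le [NeZero m] (hW : W ∈ doublyStochastic ℝ (Fin m)) {α : ℝ} (hα : 0 ≤ α)
    (X : Fin m → EuclideanSpace ℝ (Fin n)) :
    consError (step f W α X) ≤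
      beta W * consError X + α * stackNorm fun i => gradient (f i) (X i) := by
  have h : ∀ i, step f W α X i - average (step f W α X) =
      (∑ j, (W - Matrix.of fun _ _ => 1 / (m : ℝ) : Matrix (Fin m) (Fin m) ℝ) i j • (X j - average X)) -
        α • (gradient (f i) (X i) - average fun i => gradient (f i) (X i)) := by
    intro i
    rw [average_step hW, ← mix_sub_average hW, step, smul_sub]
    abel
  unfold consError
  simp only [h]
  refine (stackNorm_sub_le _ _).trans (add_le_add (stackNorm_sum_smul_le _ _) ?_)
  rw [stackNorm_smul hα]
  exact mul_le_mul_of_nonneg_left (consError_le_stackNorm _) hα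

theorem stackNorm_gradient_le [NeZero m] {L : ℝ} (hL : 0 ≤ L) (hf : ∀ i, IsLSmooth L (f i))
    (X : Fin m → EuclideanSpace ℝ (Fin n)) (xs : EuclideanSpace ℝ (Fin n)) :
    (stackNorm fun i => gradient (f i) (X i)) ≤
      L * (optError X xs + consError X) + √(m : ℝ) * gradMax f xs := by
  have h1 : (stackNorm fun i => gradient (f i) (X i) - gradient (f i) xs) ≤
      L * totalError X xs := stackNorm_le_mul hL fun i => (hf i).2 xs (X i)
  have h2 : (stackNorm fun i => gradient (f i) xs) ≤ √(m : ℝ) * gradMax f xs :=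
    stackNorm_le_sqrt_mul fun i =>
      le_ciSup (f := fun i => ‖gradient (f i) xs‖) (Set.finite_range _).bddAbove i
  have h3 := stackNorm_add_le (fun i => gradient (f i) (X i) - gradient (f i) xs)
    (fun i => gradient (f i) xs)
  simp only [sub_add_cancel] at h3
  have h4 := mul_le_mul_of_nonneg_left (totalError_le X xs) hL
  linarith

theorem optError_step_le [NeZero m] (hW : W ∈ doublyStochastic ℝ (Fin m)) {L μ α : ℝ}
    (hL : 0 < L) (hμ : 0 < μ) (hf : ∀ i, IsLSmooth L (f i))
    (hc : IsStronglyConvex μ (totalCost f)) {xs : EuclideanSpace ℝ (Fin n)}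
    (h0 : gradient (totalCost f) xs = 0) (hα : 0 ≤ α) (hα' : α ≤ 2 / (μ + L))
    (hηα : eta μ L * α ≤ 1) (X : Fin m → EuclideanSpace ℝ (Fin n)) :
    optError (step f W α X) xs ≤
      (1 - eta μ L * α) * optError X xs + α * L * consError X := by
  have hgrad : gradient (totalCost f) (average X) =
      average fun i => gradient (f i) (average X) :=
    gradient_totalCost (fun i => (hf i).1) _
  -- Mixing preserves the average, so the average makes an exact gradient step for the total cost,
  -- plus an error from taking each gradient at X i instead of at the average.
  have hdecomp : average (step f W α X) - xs =
      (average X - α • gradient (totalCost f) (average X) - xs) +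
        α • average fun i => gradient (f i) (average X) - gradient (f i) (X i) := by
    have h := average_sub_smul (fun i => gradient (f i) (average X))
      (fun i => gradient (f i) (X i)) 1
    simp only [one_smul] at h
    rw [average_step hW, h, hgrad, smul_sub]
    abel
  have h1 := hc.norm_gradient_step_le (isLSmooth_totalCost hf) hL hμ h0 hα hα' hηα (average X)
  have h2 := sqrt_mul_norm_average_le fun i => gradient (f i) (average X) - gradient (f i) (X i)
  have h3 : (stackNorm fun i => gradient (f i) (average X) - gradient (f i) (X i)) ≤
      L * consError X := by
    refine stackNorm_le_mul hL.le fun i => ?_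
    rw [norm_sub_rev (X i)]
    exact (hf i).2 _ _
  rw [optError_eq, optError_eq, hdecomp]
  have h4 := norm_add_le (average X - α • gradient (totalCost f) (average X) - xs)
    (α • average fun i => gradient (f i) (average X) - gradient (f i) (X i))
  rw [norm_smul, Real.norm_of_nonneg hα] at h4
  have h5 := mul_le_mul_of_nonneg_left (h4.trans (add_le_add_left h1 _)) (Real.sqrt_nonneg (m : ℝ))
  have h6 := mul_le_mul_of_nonneg_left (h2.trans h3) hα
  linarith

end Step

/-! ### Linear recursions and their propagators. -/

section Recursion

/-- The propagator `∏ (1 - c k)` over `s ≤ k < t` of a linear recursion. -/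
def propagator (c : ℕ → ℝ) (s t : ℕ) : ℝ := ∏ k ∈ Finset.Ico s t, (1 - c k)

variable {c : ℕ → ℝ}

theorem propagator_self (c : ℕ → ℝ) (t : ℕ) : propagator c t t = 1 := by simp [propagator]

theorem propagator_succ {s t : ℕ} (h : s ≤ t) :
    propagator c s (t + 1) = (1 - c t) * propagator c s t := by
  rw [propagator, Finset.prod_Ico_succ_top h, mul_comm, propagator]

theorem propagator_nonneg (hc : ∀ k, c k ≤ 1) (s t : ℕ) : 0 ≤ propagator c s t :=
  Finset.prod_nonneg fun k _ => sub_nonneg.2 (hc k)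

theorem propagator_le_exp (hc : ∀ k, c k ≤ 1) (s t : ℕ) :
    propagator c s t ≤ Real.exp (-∑ k ∈ Finset.Ico s t, c k) := by
  rw [← Finset.sum_neg_distrib, Real.exp_sum]
  exact Finset.prod_le_prod (fun k _ => sub_nonneg.2 (hc k)) fun k _ => Real.one_sub_le_exp_neg _

theorem propagator_le_exp_mul (hc : ∀ k, c k ≤ 1) {s t : ℕ} {κ r : ℝ} (hκ : 0 ≤ κ)
    (hκc : ∀ k < t, κ ≤ c k) (hst : s ≤ t) (hr : r ≤ (t : ℝ) - s) :
    propagator c s t ≤ Real.exp (-(κ * r)) := by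
  refine (propagator_le_exp hc s t).trans (Real.exp_le_exp.2 (neg_le_neg ?_))
  calc κ * r ≤ κ * ((t : ℝ) - s) := by gcongr
    _ = ∑ _k ∈ Finset.Ico s t, κ := by
        rw [Finset.sum_const, Nat.card_Ico, nsmul_eq_mul, Nat.cast_sub hst, mul_comm]
    _ ≤ _ := Finset.sum_le_sum fun k hk => hκc k (Finset.mem_Ico.1 hk).2

theorem le_of_linear_recursion {A b : ℕ → ℝ} (hc : ∀ k, c k ≤ 1)
    (h : ∀ t, A (t + 1) ≤ (1 - c t) * A t + b t) (t : ℕ) :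
    A t ≤ propagator c 0 t * A 0 + ∑ s ∈ Finset.range t, propagator c (s + 1) t * b s := by
  induction t with
  | zero => simp [propagator_self]
  | succ t ih =>
    refine (h t).trans ?_
    rw [Finset.sum_range_succ, propagator_self, one_mul, propagator_succ (Nat.zero_le t)]
    have e : ∑ s ∈ Finset.range t, propagator c (s + 1) (t + 1) * b s =
        (1 - c t) * ∑ s ∈ Finset.range t, propagator c (s + 1) t * b s := by
      rw [Finset.mul_sum]
      refine Finset.sum_congr rfl fun s hs => ?_
      rw [propagator_succ (Finset.mem_range.1 hs), mul_assoc]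
    rw [e]
    have := mul_le_mul_of_nonneg_left ih (sub_nonneg.2 (hc t))
    linarith

/-- Telescoping: each summand equals `propagator c (k + 1) t - propagator c k t`. This is what
controls the recent part of the sums without any loss. -/
theorem sum_propagator_mul {s t : ℕ} (h : s ≤ t) :
    ∑ k ∈ Finset.Ico s t, propagator c (k + 1) t * c k = 1 - propagator c s t := by
  induction t, h using Nat.le_induction with
  | base => simp [propagator_self]
  | succ t hst ih =>
    have e : ∑ k ∈ Finset.Ico s t, propagator c (k + 1) (t + 1) * c k =
        (1 - c t) * ∑ k ∈ Finset.Ico s t, propagator c (k + 1) t * c k := by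
      rw [Finset.mul_sum]
      refine Finset.sum_congr rfl fun k hk => ?_
      rw [propagator_succ (Finset.mem_Ico.1 hk).2, mul_assoc]
    rw [Finset.sum_Ico_succ_top hst, e, ih, propagator_self, propagator_succ hst]
    ring

theorem sum_propagator_mul_le_one (hc : ∀ k, c k ≤ 1) {s t : ℕ} (h : s ≤ t) :
    ∑ k ∈ Finset.Ico s t, propagator c (k + 1) t * c k ≤ 1 := by
  rw [sum_propagator_mul h]
  linarith [propagator_nonneg hc s t]

variable {B α : ℕ → ℝ} {β d : ℝ}

/-- The added constant is the fixed point of y ↦ βy + α(s)d, and after time s the stepsizes are at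
most α(s). -/
theorem le_of_geometric_recursion (hβ : 0 ≤ β) (hβ1 : β < 1) (hd : 0 ≤ d) (hα : Antitone α)
    (h : ∀ t, B (t + 1) ≤ β * B t + α t * d) {s t : ℕ} (hst : s ≤ t) (hs : 0 ≤ α s) :
    B t ≤ β ^ (t - s) * B s + d * α s / (1 - β) := by
  have hpos : 0 < 1 - β := sub_pos.2 hβ1
  induction t, hst using Nat.le_induction with
  | base =>
    simp only [Nat.sub_self, pow_zero, one_mul]
    linarith [div_nonneg (mul_nonneg hd hs) hpos.le]
  | succ t hst ih =>
    have h1 := mul_le_mul_of_nonneg_left ih hβ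
    have h2 := mul_le_mul_of_nonneg_right (hα hst) hd
    have e : d * α s / (1 - β) = β * (d * α s / (1 - β)) + α s * d := by
      field_simp
      ring
    rw [Nat.succ_sub hst, pow_succ, e]
    linarith [h t]

/-- Geometric averaging of the decreasing stepsizes: the memory of the first half of the
iterations is geometrically small. -/
theorem le_half_of_geometric_recursion (hβ : 0 ≤ β) (hβ1 : β < 1) (hd : 0 ≤ d) (hα : Antitone α)
    (hα0 : ∀ t, 0 ≤ α t) (hB0 : 0 ≤ B 0)
    (h : ∀ t, B (t + 1) ≤ β * B t + α t * d) (t : ℕ) :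
    B t ≤ d * α (t / 2) / (1 - β) + √β ^ t * R0 (B 0) d (α 0) β := by
  have h1 := le_of_geometric_recursion hβ hβ1 hd hα h (Nat.div_le_self t 2) (hα0 _)
  have h2 := le_of_geometric_recursion hβ hβ1 hd hα h (Nat.zero_le (t / 2)) (hα0 0)
  have h3 : B (t / 2) ≤ R0 (B 0) d (α 0) β := by
    have := mul_le_mul_of_nonneg_right (pow_le_one₀ (n := t / 2 - 0) hβ hβ1.le) hB0
    unfold R0
    linarith
  have hR : 0 ≤ R0 (B 0) d (α 0) β := by
    have : 0 < 1 - β := sub_pos.2 hβ1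
    have := hα0 0
    unfold R0
    positivity
  -- Only about half of the t steps contribute a factor β, hence the square root.
  have h4 : β ^ (t - t / 2) ≤ √β ^ t := by
    calc β ^ (t - t / 2) = √β ^ (2 * (t - t / 2)) := by rw [pow_mul, Real.sq_sqrt hβ]
      _ ≤ √β ^ t := pow_le_pow_of_le_one (Real.sqrt_nonneg _) (Real.sqrt_le_one.2 hβ1.le)
          (by omega)
  have h5 := mul_le_mul_of_nonneg_left h3 (pow_nonneg hβ (t - t / 2))
  have h6 := mul_le_mul_of_nonneg_right h4 hR
  linarith

end Recursion

/-! ### Comparison of stepsizes at nearby times. -/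

section Stepsize

variable {a w p : ℝ}

theorem add_pos_of_one_le (hw : 1 ≤ w) (t : ℕ) : 0 < (t : ℝ) + w := by positivity

theorem stepsize_pos (ha : 0 < a) (hw : 1 ≤ w) (t : ℕ) : 0 < stepsize a w p t :=
  div_pos ha (Real.rpow_pos_of_pos (add_pos_of_one_le hw t) p)

theorem stepsize_antitone (ha : 0 < a) (hw : 1 ≤ w) (hp : 0 ≤ p) : Antitone (stepsize a w p) := by
  intro s t h
  have hs := add_pos_of_one_le hw s
  have : (s : ℝ) ≤ t := by exact_mod_cast h
  unfold stepsize
  gcongr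

theorem stepsize_one_lt (ha : 0 < a) (hw : 1 ≤ w) (hp : 0 < p) :
    stepsize a w p 1 < stepsize a w p 0 := by
  unfold stepsize
  have hw0 : 0 < w := by linarith
  push_cast
  rw [zero_add]
  refine div_lt_div_of_pos_left ha (by positivity) ?_
  exact Real.rpow_lt_rpow hw0.le (by linarith) hp

/-- Here w ≥ 1 absorbs the rounding: s + w ≤ 2([s/2] + w). This is the source of 2^p in `Q0`. -/
theorem stepsize_half_le (ha : 0 < a) (hw : 1 ≤ w) (hp : 0 ≤ p) (s : ℕ) :
    stepsize a w p (s / 2) ≤ 2 ^ p * stepsize a w p s := by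
  have h1 := add_pos_of_one_le hw s
  have h2 := add_pos_of_one_le hw (s / 2)
  have h3 : (s : ℝ) ≤ 2 * (s / 2 : ℕ) + 1 := by
    have : s ≤ 2 * (s / 2) + 1 := by omega
    exact_mod_cast this
  unfold stepsize
  rw [← mul_div_assoc, div_le_div_iff₀ (by positivity) (by positivity), mul_comm (2 ^ p) a,
    mul_assoc, ← Real.mul_rpow zero_le_two h2.le]
  gcongr
  linarith

theorem sq_stepsize_eq (hw : 1 ≤ w) (s : ℕ) :
    stepsize a w p s ^ 2 = a ^ 2 / (w + (s : ℝ)) ^ (2 * p) := by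
  have h := add_pos_of_one_le hw s
  rw [stepsize, div_pow, add_comm w, mul_comm 2 p, Real.rpow_mul h.le, Real.rpow_two]

theorem one_le_Q1 (hw : 1 ≤ w) (hp : 0 ≤ p) : 1 ≤ Q1 w p := by
  refine Real.one_le_rpow ?_ (by positivity)
  rw [one_le_div (by linarith)]
  linarith

/-- The ratio (s + 1 + w)/(s + w) is largest at s = 0. The shift is needed because the sum in `Y2`
starts at s = 1. -/
theorem sq_stepsize_le (hw : 1 ≤ w) (hp : 0 ≤ p) (s : ℕ) :
    stepsize a w p s ^ 2 ≤ Q1 w p * stepsize a w p (s + 1) ^ 2 := by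
  have h1 := add_pos_of_one_le hw s
  have hw0 : 0 < w := by linarith
  rw [sq_stepsize_eq hw, sq_stepsize_eq hw, Q1, ← mul_div_assoc,
    div_le_div_iff₀ (by positivity) (by positivity), mul_comm _ (a ^ 2), mul_assoc,
    ← Real.mul_rpow (by positivity) (by positivity)]
  gcongr
  rw [div_mul_eq_mul_div, le_div_iff₀ hw0]
  push_cast
  nlinarith [Nat.cast_nonneg (α := ℝ) s]

theorem stepsize_pred_le (ha : 0 < a) (hp : 0 ≤ p) {h : ℕ} (hh : 0 < (h : ℝ) + w - 1) :
    stepsize a w p (h - 1) ≤ a * ((h : ℝ) + w - 1) ^ (-p) := by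
  have h1 : (h : ℝ) ≤ ((h - 1 : ℕ) : ℝ) + 1 := by
    have : h ≤ (h - 1) + 1 := by omega
    exact_mod_cast this
  rw [Real.rpow_neg hh.le, ← div_eq_mul_inv]
  unfold stepsize
  gcongr
  linarith

end Stepsize

/-! ### Splitting the sums near t/2 and the rate estimate. -/

section Estimate

variable {a w p η : ℝ}

theorem le_stepsize_of_le (ha : 0 < a) (hw : 1 ≤ w) (hp : 0 ≤ p) (hη : 0 ≤ η) {k t : ℕ}
    (h : k ≤ t) : η * a / ((t : ℝ) + w) ^ p ≤ η * stepsize a w p k := by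
  rw [mul_div_assoc]
  exact mul_le_mul_of_nonneg_left (stepsize_antitone ha hw hp h) hη

theorem sum_propagator_mul_sq_stepsize_le (ha : 0 < a) (hw : 1 ≤ w) (hp : 0 ≤ p) (hη : 0 < η)
    (hc : ∀ k, η * stepsize a w p k ≤ 1) {t : ℕ} (ht : 0 < ((t / 2 : ℕ) : ℝ) + w - 1) :
    η * ∑ s ∈ Finset.range t,
        propagator (fun k => η * stepsize a w p k) (s + 1) t * stepsize a w p s ^ 2 ≤
      a * (((t / 2 : ℕ) : ℝ) + w - 1) ^ (-p) +
        η * Q1 w p * Real.exp (-(η * a / 2) * ((t : ℝ) / ((t : ℝ) + w) ^ p)) *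
          ∑ s ∈ Finset.Icc 1 (t / 2 - 1), a ^ 2 / (w + (s : ℝ)) ^ (2 * p) := by
  set c : ℕ → ℝ := fun k => η * stepsize a w p k with hcdef
  set x := Real.exp (-(η * a / 2) * ((t : ℝ) / ((t : ℝ) + w) ^ p)) with hx
  have hα : ∀ k, 0 < stepsize a w p k := stepsize_pos ha hw
  have htw := add_pos_of_one_le hw t
  have hsplit : t / 2 - 1 ≤ t := by omega
  -- Late terms give up one stepsize, at most α(t/2 - 1), and the rest telescopes. In early terms
  -- the propagator still has at least t/2 factors, each with decrement at least ηα(t).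
  rw [← Finset.sum_range_add_sum_Ico _ hsplit, mul_add, add_comm]
  refine add_le_add ?_ ?_
  · calc η * ∑ s ∈ Finset.Ico (t / 2 - 1) t, propagator c (s + 1) t * stepsize a w p s ^ 2
        ≤ ∑ s ∈ Finset.Ico (t / 2 - 1) t,
            stepsize a w p (t / 2 - 1) * (propagator c (s + 1) t * c s) := by
          rw [Finset.mul_sum]
          refine Finset.sum_le_sum fun s hs => ?_
          have h1 := stepsize_antitone ha hw hp (Finset.mem_Ico.1 hs).1
          have h2 : 0 ≤ η * propagator c (s + 1) t * stepsize a w p s :=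
            mul_nonneg (mul_nonneg hη.le (propagator_nonneg hc _ _)) (hα s).le
          have h3 := mul_le_mul_of_nonneg_left h1 h2
          rw [hcdef] at h3 ⊢
          linarith
      _ ≤ stepsize a w p (t / 2 - 1) := by
          rw [← Finset.mul_sum]
          exact mul_le_of_le_one_right (hα _).le (sum_propagator_mul_le_one hc hsplit)
      _ ≤ _ := stepsize_pred_le ha hp ht
  · have e : ∑ s ∈ Finset.Icc 1 (t / 2 - 1), a ^ 2 / (w + (s : ℝ)) ^ (2 * p) =
        ∑ s ∈ Finset.range (t / 2 - 1), stepsize a w p (s + 1) ^ 2 := by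
      rw [Finset.range_eq_Ico, Finset.sum_Ico_add' (fun s => stepsize a w p s ^ 2) 0 _ 1]
      exact Finset.sum_congr rfl fun s _ => (sq_stepsize_eq hw s).symm
    rw [e, mul_assoc, mul_assoc]
    refine mul_le_mul_of_nonneg_left ?_ hη.le
    rw [Finset.mul_sum, Finset.mul_sum]
    refine Finset.sum_le_sum fun s hs => ?_
    have hs := Finset.mem_range.1 hs
    have hst : s + 1 ≤ t := by omega
    have h1 : propagator c (s + 1) t ≤ x := by
      have h2 : (t : ℝ) / 2 ≤ (t : ℝ) - (s + 1 : ℕ) := by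
        have : 2 * (s + 1) ≤ t := by omega
        have : (2 : ℝ) * (s + 1 : ℕ) ≤ t := by exact_mod_cast this
        linarith
      refine (propagator_le_exp_mul hc (κ := η * a / ((t : ℝ) + w) ^ p) (by positivity)
        (fun k hk => le_stepsize_of_le ha hw hp hη.le hk.le) hst h2).trans_eq ?_
      rw [hx]
      congr 1
      ring
    calc propagator c (s + 1) t * stepsize a w p s ^ 2
        ≤ x * (Q1 w p * stepsize a w p (s + 1) ^ 2) :=
          mul_le_mul h1 (sq_stepsize_le hw hp s) (sq_nonneg _) (Real.exp_pos _).le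
      _ = _ := by ring

theorem floor_half (k : ℕ) : ⌊(((k + 1 : ℕ) : ℝ) - 1) / 2⌋ = ((k / 2 : ℕ) : ℤ) := by
  rw [Int.floor_eq_iff]
  have h1 : 2 * (k / 2) ≤ k := by omega
  have h2 : k < 2 * (k / 2) + 2 := by omega
  have h1' : (2 : ℝ) * (k / 2 : ℕ) ≤ k := by exact_mod_cast h1
  have h2' : (k : ℝ) < 2 * (k / 2 : ℕ) + 2 := by exact_mod_cast h2
  rw [Int.cast_natCast, Nat.cast_add, Nat.cast_one]
  constructor <;> linarith

theorem sum_propagator_mul_pow_le (ha : 0 < a) (hw : 1 ≤ w) (hp : 0 ≤ p) (hη : 0 < η)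
    (hc : ∀ k, η * stepsize a w p k ≤ 1) {b : ℝ} (hb : 0 ≤ b) (hb1 : b < 1) (t : ℕ) :
    ∑ s ∈ Finset.range t, propagator (fun k => η * stepsize a w p k) (s + 1) t * b ^ s ≤
      Real.exp (-(η * a / 2) * (((t : ℝ) - 1) / ((t : ℝ) + w) ^ p)) / (1 - b) +
        b ^ ⌊((t : ℝ) - 1) / 2⌋ / (1 - b) := by
  have hb' : 0 < 1 - b := sub_pos.2 hb1
  rcases t with _ | k
  -- At t = 0 the floor is -1. Only nonnegativity of the integer power matters, also for b = 0,
  -- where it is 0.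
  · rw [Finset.range_zero, Finset.sum_empty]
    have := zpow_nonneg hb ⌊(((0 : ℕ) : ℝ) - 1) / 2⌋
    positivity
  · rw [floor_half, zpow_natCast]
    set c : ℕ → ℝ := fun k => η * stepsize a w p k with hcdef
    set t := k + 1 with ht
    set x := Real.exp (-(η * a / 2) * (((t : ℝ) - 1) / ((t : ℝ) + w) ^ p)) with hx
    have hα : ∀ k, 0 < stepsize a w p k := stepsize_pos ha hw
    have htw := add_pos_of_one_le hw t
    have hsplit : k / 2 ≤ t := by omega
    rw [← Finset.sum_range_add_sum_Ico _ hsplit]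
    refine add_le_add ?_ ?_
    · calc ∑ s ∈ Finset.range (k / 2), propagator c (s + 1) t * b ^ s
          ≤ ∑ s ∈ Finset.range (k / 2), x * b ^ s := by
            refine Finset.sum_le_sum fun s hs => ?_
            have hs := Finset.mem_range.1 hs
            refine mul_le_mul_of_nonneg_right ?_ (pow_nonneg hb s)
            have h2 : ((t : ℝ) - 1) / 2 ≤ (t : ℝ) - (s + 1 : ℕ) := by
              have : 2 * (s + 1) ≤ t + 1 := by omega
              have : (2 : ℝ) * (s + 1 : ℕ) ≤ t + 1 := by exact_mod_cast this
              linarith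
            refine (propagator_le_exp_mul hc (κ := η * a / ((t : ℝ) + w) ^ p) (by positivity)
              (fun k hk => le_stepsize_of_le ha hw hp hη.le hk.le) (by omega) h2).trans_eq ?_
            rw [hx]
            congr 1
            ring
        _ ≤ x / (1 - b) := by
            rw [← Finset.mul_sum, Finset.range_eq_Ico, div_eq_mul_one_div]
            refine mul_le_mul_of_nonneg_left ?_ (Real.exp_pos _).le
            simpa using geom_sum_Ico_le_of_lt_one (m := 0) (n := k / 2) hb hb1
    · refine le_trans (Finset.sum_le_sum fun s _ => ?_)
        (geom_sum_Ico_le_of_lt_one (m := k / 2) (n := t) hb hb1)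
      refine mul_le_of_le_one_left (pow_nonneg hb s) ?_
      refine Finset.prod_le_one (fun i _ => sub_nonneg.2 (hc i)) fun i _ => ?_
      have := mul_pos hη (hα i)
      simp only [hcdef]
      linarith

/-- The rate estimate for the coupled recursions of the optimality and consensus errors. -/
theorem optimality_estimate (ha : 0 < a) (hw : 1 ≤ w) (hp : 0 ≤ p) (hη : 0 < η)
    (hc : ∀ k, η * stepsize a w p k ≤ 1) {β L d e₀ : ℝ} (hβ : 0 ≤ β) (hβ1 : β < 1) (hL : 0 ≤ L)
    (hd : 0 ≤ d) {A B : ℕ → ℝ} (hA0 : A 0 ≤ e₀) (hB0 : 0 ≤ B 0)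
    (hA : ∀ t, A (t + 1) ≤ (1 - η * stepsize a w p t) * A t + stepsize a w p t * L * B t)
    (hB : ∀ t, B (t + 1) ≤ β * B t + stepsize a w p t * d) {t : ℕ}
    (ht : 0 < ((t / 2 : ℕ) : ℝ) + w - 1) (he₀ : 0 ≤ e₀) :
    A t ≤ Q0 w p L d η * √(Real.exp 1) * a / (1 - β) * (((t / 2 : ℕ) : ℝ) + w - 1) ^ (-p)
      + Y1 a w p η e₀ t + Y2 a w p η β (Q0 w p L d η) t
      + Y3 a w p η β L (R0 (B 0) d (stepsize a w p 0) β) t := by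
  have hβ' : 0 < 1 - β := sub_pos.2 hβ1
  have hα : ∀ k, 0 < stepsize a w p k := stepsize_pos ha hw
  set r := R0 (B 0) d (stepsize a w p 0) β with hr
  have hr0 : 0 ≤ r := by
    have := hα 0
    rw [hr]
    unfold R0
    positivity
  set c : ℕ → ℝ := fun k => η * stepsize a w p k with hcdef
  have hP := propagator_nonneg hc
  have h0 := le_of_linear_recursion hc hA t
  have h1 : propagator c 0 t * A 0 ≤ Y1 a w p η e₀ t := by
    refine (mul_le_mul_of_nonneg_left hA0 (hP 0 t)).trans ?_
    unfold Y1
    refine mul_le_mul_of_nonneg_right ((propagator_le_exp hc 0 t).trans_eq ?_) he₀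
    rw [← Finset.range_eq_Ico]
    simp only [stepsize, mul_div_assoc]
  set S := ∑ s ∈ Finset.range t, propagator c (s + 1) t * stepsize a w p s ^ 2 with hS
  set T := ∑ s ∈ Finset.range t, propagator c (s + 1) t * √β ^ s with hT
  -- The consensus bound has two parts: α(s)α(s/2) ≤ 2^p α(s)² feeds S, and the geometric part feeds
  -- T.
  have h2 : ∑ s ∈ Finset.range t, propagator c (s + 1) t * (stepsize a w p s * L * B s) ≤
      L * d * 2 ^ p / (1 - β) * S + stepsize a w p 0 * L * r * T := by
    rw [hS, hT, Finset.mul_sum, Finset.mul_sum, ← Finset.sum_add_distrib]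
    refine Finset.sum_le_sum fun s _ => ?_
    have hBs := le_half_of_geometric_recursion hβ hβ1 hd (stepsize_antitone ha hw hp)
      (fun t => (hα t).le) hB0 hB s
    have e1 : d * stepsize a w p (s / 2) / (1 - β) ≤
        d * 2 ^ p / (1 - β) * stepsize a w p s := by
      have := mul_le_mul_of_nonneg_left (stepsize_half_le ha hw hp s) (div_nonneg hd hβ'.le)
      calc _ = d / (1 - β) * stepsize a w p (s / 2) := by ring
        _ ≤ _ := this
        _ = _ := by ring
    have e2 : stepsize a w p s * (L * (√β ^ s * r)) ≤
        stepsize a w p 0 * (L * (√β ^ s * r)) :=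
      mul_le_mul_of_nonneg_right (stepsize_antitone ha hw hp (Nat.zero_le s))
        (by positivity)
    have e3 : stepsize a w p s * L * B s ≤ L * d * 2 ^ p / (1 - β) * stepsize a w p s ^ 2 +
        stepsize a w p 0 * L * r * √β ^ s := by
      have := mul_le_mul_of_nonneg_left (hBs.trans (add_le_add_left e1 _))
        (mul_nonneg (hα s).le hL)
      calc _ ≤ _ := this
        _ = L * d * 2 ^ p / (1 - β) * stepsize a w p s ^ 2 +
            stepsize a w p s * (L * (√β ^ s * r)) := by ring
        _ ≤ _ := by linarith
    have := mul_le_mul_of_nonneg_left e3 (hP (s + 1) t)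
    linarith
  have h3 := sum_propagator_mul_sq_stepsize_le ha hw hp hη hc ht
  have h4 := sum_propagator_mul_pow_le ha hw hp hη hc (Real.sqrt_nonneg β)
    (by rw [Real.sqrt_lt' one_pos]; simpa using hβ1) t
  have h5 : L * d * 2 ^ p / (1 - β) * S ≤
      Q0 w p L d η * √(Real.exp 1) * a / (1 - β) * (((t / 2 : ℕ) : ℝ) + w - 1) ^ (-p) +
        Y2 a w p η β (Q0 w p L d η) t := by
    set z := (((t / 2 : ℕ) : ℝ) + w - 1) ^ (-p) with hz
    have hz0 : 0 ≤ z := Real.rpow_nonneg ht.le _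
    -- The late part of the sum does not need the factor Q₁√e; being at least 1, it may be inserted
    -- to match the stated constant.
    have hq : 1 ≤ Q1 w p * √(Real.exp 1) := by
      have : 1 ≤ √(Real.exp 1) := Real.one_le_sqrt.2 (Real.one_le_exp zero_le_one)
      exact one_le_mul_of_one_le_of_one_le (one_le_Q1 hw hp) this
    have hk : 0 ≤ L * d * 2 ^ p / (1 - β) / η := by positivity
    have h6 := mul_le_mul_of_nonneg_left h3 hk
    have h7 := mul_le_mul_of_nonneg_left hq (mul_nonneg hk (mul_nonneg ha.le hz0))
    calc L * d * 2 ^ p / (1 - β) * S = L * d * 2 ^ p / (1 - β) / η * (η * S) := by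
          field_simp
      _ ≤ _ := h6
      _ ≤ L * d * 2 ^ p / (1 - β) / η * (a * z) * (Q1 w p * √(Real.exp 1)) + _ := by
          rw [mul_add]
          refine add_le_add_left ?_ _
          rwa [mul_one] at h7
      _ = _ := by
          unfold Y2 Q0
          field_simp
  have h6 : stepsize a w p 0 * L * r * T ≤ Y3 a w p η β L r t := by
    have hk : 0 ≤ stepsize a w p 0 * L * r :=
      mul_nonneg (mul_nonneg (hα 0).le hL) hr0
    have hT0 : 0 ≤ T := Finset.sum_nonneg fun s _ =>
      mul_nonneg (hP _ _) (pow_nonneg (Real.sqrt_nonneg _) _)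
    have hk' : stepsize a w p 0 * L * r ≤ a * L * r / ((1 - β) * w ^ p) := by
      have hw0 : 0 < w := by linarith
      have e : a * L * r / ((1 - β) * w ^ p) = stepsize a w p 0 * L * r / (1 - β) := by
        simp only [stepsize, Nat.cast_zero, zero_add]
        field_simp
      rw [e, le_div_iff₀ hβ']
      exact mul_le_of_le_one_right hk (by linarith)
    unfold Y3
    exact mul_le_mul hk' h4 hT0 (hk.trans hk')
  linarith

end Estimate

/-! ### Superpolynomial decay of the remainder terms. -/

section Decay

open Filter Asymptotics

variable {a w p : ℝ}

/-- For t ≥ 1, t + w ≤ (1 + w)t, so the exponent is at least a multiple of t^(1-p) in size, a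
positive power of t. -/
theorem isBigO_exp_neg_mul_div_rpow (hw : 1 ≤ w) (hp : 0 ≤ p) (hp1 : p < 1) {c : ℝ} (hc : 0 < c)
    (N : ℝ) : (fun t : ℕ => Real.exp (-c * ((t : ℝ) / ((t : ℝ) + w) ^ p))) =O[atTop]
      fun t : ℕ => (t : ℝ) ^ (-N) := by
  have hq : 0 < 1 - p := sub_pos.2 hp1
  have hw0 : 0 < 1 + w := by linarith
  set c' := c / (1 + w) ^ p with hc'
  have hc'0 : 0 < c' := by positivity
  have h1 : (fun t : ℕ => Real.exp (-c' * (t : ℝ) ^ (1 - p))) =O[atTop]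
      fun t : ℕ => (t : ℝ) ^ (-N) := by
    have h := (isLittleO_exp_neg_mul_rpow_atTop hc'0 (-N / (1 - p))).comp_tendsto
      ((tendsto_rpow_atTop hq).comp tendsto_natCast_atTop_atTop)
    refine h.isBigO.congr_right fun t => ?_
    simp only [Function.comp]
    rw [← Real.rpow_mul (Nat.cast_nonneg t), mul_div_cancel₀ _ hq.ne']
  refine IsBigO.trans (IsBigO.of_bound 1 ?_) h1
  filter_upwards [eventually_ge_atTop 1] with t ht
  have ht1 : (1 : ℝ) ≤ t := by exact_mod_cast ht
  have ht0 : (0 : ℝ) < t := by linarith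
  rw [one_mul, Real.norm_of_nonneg (Real.exp_pos _).le, Real.norm_of_nonneg (Real.exp_pos _).le]
  refine Real.exp_le_exp.2 ?_
  rw [neg_mul, neg_mul]
  refine neg_le_neg ?_
  rw [hc', Real.rpow_sub ht0, Real.rpow_one, div_mul_div_comm, ← mul_div_assoc,
    ← Real.mul_rpow hw0.le ht0.le]
  gcongr
  nlinarith

theorem isBigO_exp_neg_mul (N : ℝ) {c : ℝ} (hc : 0 < c) :
    (fun t : ℕ => Real.exp (-c * (t : ℝ))) =O[atTop] fun t : ℕ => (t : ℝ) ^ (-N) :=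
  ((isLittleO_exp_neg_mul_rpow_atTop hc (-N)).comp_tendsto tendsto_natCast_atTop_atTop).isBigO

theorem isBigO_pow_half {b : ℝ} (hb : 0 ≤ b) (hb1 : b < 1) (N : ℝ) :
    (fun t : ℕ => b ^ ⌊((t : ℝ) - 1) / 2⌋) =O[atTop] fun t : ℕ => (t : ℝ) ^ (-N) := by
  -- Raising the base keeps the logarithm meaningful when b = 0.
  set q := max b (1 / 2) with hq
  have hq0 : 0 < q := lt_max_of_lt_right (by norm_num)
  have hq1 : q < 1 := max_lt hb1 (by norm_num)
  have hlog : 0 < -Real.log q := neg_pos.2 (Real.log_neg hq0 hq1)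
  refine IsBigO.trans (IsBigO.of_bound (Real.exp (-Real.log q)) ?_)
    (isBigO_exp_neg_mul N (half_pos hlog))
  filter_upwards [eventually_ge_atTop 1] with t ht
  obtain ⟨k, rfl⟩ : ∃ k, t = k + 1 := ⟨t - 1, by omega⟩
  rw [floor_half, zpow_natCast, Real.norm_of_nonneg (pow_nonneg hb _),
    Real.norm_of_nonneg (Real.exp_pos _).le, ← Real.exp_add]
  calc b ^ (k / 2) ≤ q ^ (k / 2) := pow_le_pow_left₀ hb (le_max_left _ _) _
    _ = Real.exp ((k / 2 : ℕ) * Real.log q) := by rw [Real.exp_nat_mul, Real.exp_log hq0]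
    _ ≤ _ := by
      refine Real.exp_le_exp.2 ?_
      have : k + 1 ≤ 2 * (k / 2) + 2 := by omega
      have : ((k + 1 : ℕ) : ℝ) ≤ 2 * (k / 2 : ℕ) + 2 := by exact_mod_cast this
      nlinarith

variable {η : ℝ}

theorem isBigO_Y1 (ha : 0 < a) (hw : 1 ≤ w) (hp : 0 ≤ p) (hp1 : p < 1) (hη : 0 < η) (e₀ N : ℝ) :
    Y1 a w p η e₀ =O[atTop] fun t : ℕ => (t : ℝ) ^ (-N) := by
  have h : (fun t : ℕ => Real.exp (-∑ s ∈ Finset.range t, η * a / ((s : ℝ) + w) ^ p)) =O[atTop]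
      fun t : ℕ => (t : ℝ) ^ (-N) := by
    refine IsBigO.trans (IsBigO.of_bound 1 (Eventually.of_forall fun t => ?_))
      (isBigO_exp_neg_mul_div_rpow hw hp hp1 (mul_pos hη ha) N)
    rw [one_mul, Real.norm_of_nonneg (Real.exp_pos _).le, Real.norm_of_nonneg (Real.exp_pos _).le]
    refine Real.exp_le_exp.2 ?_
    rw [neg_mul]
    refine neg_le_neg ?_
    calc η * a * ((t : ℝ) / ((t : ℝ) + w) ^ p)
        = ∑ _s ∈ Finset.range t, η * a / ((t : ℝ) + w) ^ p := by
          rw [Finset.sum_const, Finset.card_range, nsmul_eq_mul]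
          ring
      _ ≤ _ := by
          refine Finset.sum_le_sum fun s hs => ?_
          have := le_stepsize_of_le ha hw hp hη.le (Finset.mem_range.1 hs).le
          rwa [stepsize, ← mul_div_assoc] at this
  have := h.const_mul_left e₀
  exact this.congr_left fun t => mul_comm _ _

theorem isBigO_Y2 (ha : 0 < a) (hw : 1 ≤ w) (hp : 0 ≤ p) (hp1 : p < 1) (hη : 0 < η)
    (β q₀ N : ℝ) : Y2 a w p η β q₀ =O[atTop] fun t : ℕ => (t : ℝ) ^ (-N) := by
  -- The extra power pays for the sum, which is at most a²t.
  have h1 := isBigO_exp_neg_mul_div_rpow hw hp hp1 (half_pos (mul_pos hη ha)) (N + 1)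
  have h2 : (fun t : ℕ => ∑ s ∈ Finset.Icc 1 (t / 2 - 1), a ^ 2 / (w + (s : ℝ)) ^ (2 * p))
      =O[atTop] fun t : ℕ => (t : ℝ) := by
    refine IsBigO.of_bound (a ^ 2) (Eventually.of_forall fun t => ?_)
    have hnn : ∀ s ∈ Finset.Icc 1 (t / 2 - 1), 0 ≤ a ^ 2 / (w + (s : ℝ)) ^ (2 * p) :=
      fun s _ => by positivity
    rw [Real.norm_of_nonneg (Finset.sum_nonneg hnn), Real.norm_of_nonneg (Nat.cast_nonneg t)]
    calc _ ≤ ∑ s ∈ Finset.Icc 1 (t / 2 - 1), a ^ 2 := by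
          refine Finset.sum_le_sum fun s _ => div_le_self (sq_nonneg a) ?_
          exact Real.one_le_rpow (by linarith [Nat.cast_nonneg (α := ℝ) s]) (by positivity)
      _ = a ^ 2 * (t / 2 - 1 : ℕ) := by
          rw [Finset.sum_const, Nat.card_Icc, nsmul_eq_mul, Nat.add_sub_cancel, mul_comm]
      _ ≤ a ^ 2 * t := by
          gcongr
          omega
  have h3 := (h1.const_mul_left (η * q₀ / (1 - β))).mul h2
  refine h3.trans (IsBigO.of_bound 1 ?_)
  filter_upwards [eventually_ge_atTop 1] with t ht
  have ht0 : (0 : ℝ) < t := by exact_mod_cast ht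
  rw [one_mul]
  refine le_of_eq (congrArg _ ?_)
  nth_rewrite 2 [← Real.rpow_one (t : ℝ)]
  rw [← Real.rpow_add ht0]
  congr 1
  ring

theorem isBigO_Y3 (ha : 0 < a) (hw : 1 ≤ w) (hp : 0 ≤ p) (hp1 : p < 1) (hη : 0 < η)
    {β : ℝ} (hβ1 : β < 1) (L r₀ N : ℝ) :
    Y3 a w p η β L r₀ =O[atTop] fun t : ℕ => (t : ℝ) ^ (-N) := by
  have hk : 0 < η * a / 2 := half_pos (mul_pos hη ha)
  have h1 : (fun t : ℕ => Real.exp (-(η * a / 2) * (((t : ℝ) - 1) / ((t : ℝ) + w) ^ p)))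
      =O[atTop] fun t : ℕ => (t : ℝ) ^ (-N) := by
    refine IsBigO.trans (IsBigO.of_bound (Real.exp (η * a / 2))
      (Eventually.of_forall fun t => ?_)) (isBigO_exp_neg_mul_div_rpow hw hp hp1 hk N)
    rw [Real.norm_of_nonneg (Real.exp_pos _).le, Real.norm_of_nonneg (Real.exp_pos _).le,
      ← Real.exp_add]
    refine Real.exp_le_exp.2 ?_
    have h : 1 / ((t : ℝ) + w) ^ p ≤ 1 :=
      div_le_self zero_le_one (Real.one_le_rpow (by linarith [Nat.cast_nonneg (α := ℝ) t]) hp)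
    have h' := mul_le_mul_of_nonneg_left h hk.le
    rw [sub_div]
    linarith
  have h2 := isBigO_pow_half (Real.sqrt_nonneg β)
    (by rw [Real.sqrt_lt' one_pos]; simpa using hβ1) N
  have h3 := ((h1.const_mul_left (1 / (1 - √β))).add
    (h2.const_mul_left (1 / (1 - √β)))).const_mul_left (a * L * r₀ / ((1 - β) * w ^ p))
  refine h3.congr_left fun t => ?_
  unfold Y3
  ring

theorem isBigO_half_rpow (hw : 1 ≤ w) (hp : 0 ≤ p) :
    (fun t : ℕ => (((t / 2 : ℕ) : ℝ) + w - 1) ^ (-p)) =O[atTop] fun t : ℕ => (t : ℝ) ^ (-p) := by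
  refine IsBigO.of_bound (4 ^ p) ?_
  filter_upwards [eventually_ge_atTop 2] with t ht
  have ht0 : (0 : ℝ) < t := by
    have : 0 < t := by omega
    exact_mod_cast this
  have h : t ≤ 4 * (t / 2) := by omega
  have h : (t : ℝ) ≤ 4 * (t / 2 : ℕ) := by exact_mod_cast h
  have hle : (t : ℝ) / 4 ≤ ((t / 2 : ℕ) : ℝ) + w - 1 := by linarith
  have hpos : 0 < (t : ℝ) / 4 := by positivity
  rw [Real.norm_of_nonneg (Real.rpow_nonneg (hpos.le.trans hle) _),
    Real.norm_of_nonneg (Real.rpow_nonneg ht0.le _)]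
  refine (Real.rpow_le_rpow_of_nonpos hpos hle (neg_nonpos.2 hp)).trans_eq ?_
  rw [Real.div_rpow ht0.le (by norm_num), Real.rpow_neg (by norm_num : (0 : ℝ) ≤ 4), div_inv_eq_mul,
    mul_comm]

end Decay

/-! ### Uniform boundedness of the iterates. -/

section Boundedness

/-- Coupled recursions of the optimality and consensus errors stay bounded when the stepsizes are
strictly below the critical one after the first step. -/
theorem exists_bound_of_coupled_recursion {A B α : ℕ → ℝ} {η β L s : ℝ} (hη : 0 < η)
    (hL : 0 < L) (hs : 0 ≤ s) (hα : ∀ t, 0 < α t) (hanti : Antitone α)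
    (hα1 : α 1 < α 0) (hα0 : α 0 ≤ η * (1 - β) / (L * (η + L))) (hβ : 0 ≤ β)
    (hηα : ∀ t, η * α t ≤ 1)
    (hA : ∀ t, A (t + 1) ≤ (1 - η * α t) * A t + α t * L * B t)
    (hB : ∀ t, B (t + 1) ≤ β * B t + α t * (L * (A t + B t) + s)) :
    ∃ R, 0 < R ∧ ∀ t, A t ≤ R ∧ B t ≤ R := by
  have hLη : 0 < L * (η + L) := by positivity
  rw [le_div_iff₀ hLη] at hα0
  -- The bound on α(0) may be an equality; the strict drop to α(1) is what leaves room for the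
  -- inhomogeneous term s.
  set δ := η * (1 - β) - α 1 * (L * (η + L)) with hδ
  have hδ0 : 0 < δ := by
    have := mul_lt_mul_of_pos_right hα1 hLη
    linarith
  -- The box A ≤ R, B ≤ ηR/L is balanced so that the recursion for A preserves it exactly; the last
  -- condition is what the recursion for B needs.
  obtain ⟨R, hR0, hRA, hRB, hRs⟩ : ∃ R, 0 ≤ R ∧ A 1 ≤ R ∧ B 1 ≤ η * R / L ∧
      α 1 * s * L ≤ δ * R := by
    refine ⟨max (max 0 (A 1)) (max (B 1 * L / η) (α 1 * s * L / δ)), ?_, ?_, ?_, ?_⟩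
    · exact (le_max_left _ _).trans (le_max_left _ _)
    · exact (le_max_right _ _).trans (le_max_left _ _)
    · have h : B 1 * L / η ≤ max (max 0 (A 1)) (max (B 1 * L / η) (α 1 * s * L / δ)) :=
        (le_max_left _ _).trans (le_max_right _ _)
      rw [div_le_iff₀ hη] at h
      rw [le_div_iff₀ hL]
      linarith
    · have h : α 1 * s * L / δ ≤ max (max 0 (A 1)) (max (B 1 * L / η) (α 1 * s * L / δ)) :=
        (le_max_right _ _).trans (le_max_right _ _)
      rw [div_le_iff₀ hδ0] at h
      linarith
  set b := η * R / L with hb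
  have hbL : b * L = η * R := by rw [hb]; field_simp
  have hb0 : 0 ≤ b := by positivity
  have hinv : ∀ t, A (t + 1) ≤ R ∧ B (t + 1) ≤ b := by
    intro t
    induction t with
    | zero => exact ⟨hRA, hRB⟩
    | succ t ih =>
      obtain ⟨ihA, ihB⟩ := ih
      have hαt := hα (t + 1)
      have hαt1 : α (t + 1) ≤ α 1 := hanti (Nat.le_add_left 1 t)
      constructor
      · have h1 := mul_le_mul_of_nonneg_left ihA (sub_nonneg.2 (hηα (t + 1)))
        have h2 := mul_le_mul_of_nonneg_left ihB (mul_pos hαt hL).le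
        have h3 : α (t + 1) * L * b = η * α (t + 1) * R := by linear_combination α (t + 1) * hbL
        linarith [hA (t + 1)]
      · have h1 := mul_le_mul_of_nonneg_left ihB hβ
        have h2 : α (t + 1) * (L * (A (t + 1) + B (t + 1)) + s) ≤ α 1 * (L * (R + b) + s) := by
          have h3 : L * (A (t + 1) + B (t + 1)) + s ≤ L * (R + b) + s := by gcongr
          exact (mul_le_mul_of_nonneg_left h3 hαt.le).trans
            (mul_le_mul_of_nonneg_right hαt1 (by positivity))
        have h4 : β * b + α 1 * (L * (R + b) + s) ≤ b := by
          rw [← mul_le_mul_iff_of_pos_right hL]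
          have e : (β * b + α 1 * (L * (R + b) + s)) * L =
              β * (b * L) + α 1 * (L * (R * L + b * L) + s * L) := by ring
          rw [e, hbL]
          rw [hδ] at hRs
          linarith
        linarith [hB (t + 1)]
  refine ⟨max (max (A 0) (B 0)) (max R b) + 1, ?_, fun t => ?_⟩
  · have : R ≤ max (max (A 0) (B 0)) (max R b) := (le_max_left _ _).trans (le_max_right _ _)
    linarith
  · have e1 : A 0 ≤ max (max (A 0) (B 0)) (max R b) := (le_max_left _ _).trans (le_max_left _ _)
    have e2 : B 0 ≤ max (max (A 0) (B 0)) (max R b) := (le_max_right _ _).trans (le_max_left _ _)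
    have e3 : R ≤ max (max (A 0) (B 0)) (max R b) := (le_max_left _ _).trans (le_max_right _ _)
    have e4 : b ≤ max (max (A 0) (B 0)) (max R b) := (le_max_right _ _).trans (le_max_right _ _)
    rcases t with _ | t
    · exact ⟨by linarith, by linarith⟩
    · exact ⟨by linarith [(hinv t).1], by linarith [(hinv t).2]⟩

end Boundedness

end DGD

/-! ### The theorem, assembled from the coupled recursions. -/

theorem theorem2 {m n : ℕ} (f : Fin m → EuclideanSpace ℝ (Fin n) → ℝ)
    (Lc : Fin m → ℝ) (L μ η : ℝ)
    -- each local cost is `L_i`-smooth, `L = max_i L_i`, and the total cost is strongly convex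
    (hLc : ∀ i, 0 < Lc i) (hsmooth : ∀ i, DGD.IsLSmooth (Lc i) (f i))
    (hL : IsGreatest (Set.range Lc) L)
    (hμ : 0 < μ) (hconv : DGD.IsStronglyConvex μ (DGD.totalCost f))
    (hη : η = DGD.eta μ L)
    -- connected communication graph and mixing matrix
    (G : SimpleGraph (Fin m)) (hG : G.Connected)
    (W : Matrix (Fin m) (Fin m) ℝ) (hW : DGD.IsMixingMatrix G W)
    (β : ℝ) (hβ : β = DGD.beta W)
    -- stepsize `α(t) = a / (t + w)^p`
    (a w p : ℝ) (ha : 0 < a) (hw : 1 ≤ w) (hp : p ∈ Set.Ioo (0 : ℝ) 1)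
    (α : ℕ → ℝ) (hα : α = DGD.stepsize a w p)
    (hstep : α 0 ≤ min (2 / (μ + L)) (η * (1 - β) / (L * (η + L))))
    -- the iterates, with arbitrary initial states
    (x₀ : Fin m → EuclideanSpace ℝ (Fin n))
    (x : ℕ → Fin m → EuclideanSpace ℝ (Fin n)) (hx : x = DGD.iterate f W α x₀) :
    -- the total cost has exactly one minimizer `xs`
    ∃ xs : EuclideanSpace ℝ (Fin n),
      (∀ z, IsMinOn (DGD.totalCost f) Set.univ z ↔ z = xs) ∧
      -- the iterates are uniformly bounded
      (∃ R : ℝ, 0 < R ∧ DGD.IsUniformBound x xs R) ∧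
      -- the estimates, with the constants formed from any uniform bound `R`
      (∀ R d r₀ q₀ : ℝ, DGD.IsUniformBound x xs R →
        d = DGD.dConst m L R (DGD.gradMax f xs) →
        r₀ = DGD.R0 (DGD.consError (x 0)) d (α 0) β →
        q₀ = DGD.Q0 w p L d η →
        -- the condition excludes only `w = 1`, `t ≤ 1`, where `0 ^ (-p)` is infinite
        (∀ t : ℕ, 0 < ((t / 2 : ℕ) : ℝ) + w - 1 →
          DGD.optError (x t) xs ≤
            q₀ * √(Real.exp 1) * a / (1 - β) * (((t / 2 : ℕ) : ℝ) + w - 1) ^ (-p)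
              + DGD.Y1 a w p η (DGD.totalError (x 0) xs) t
              + DGD.Y2 a w p η β q₀ t
              + DGD.Y3 a w p η β L r₀ t) ∧
        -- the last three terms decay faster than any power of `t`
        (∀ N : ℝ, 0 < N → ∃ C : ℝ, 0 < C ∧ ∀ t : ℕ, 1 ≤ t →
          DGD.Y1 a w p η (DGD.totalError (x 0) xs) t
              + DGD.Y2 a w p η β q₀ t
              + DGD.Y3 a w p η β L r₀ t ≤ C * (t : ℝ) ^ (-N))) ∧
      -- hence the rate
      (fun t : ℕ => DGD.optError (x t) xs) =O[Filter.atTop] (fun t : ℕ => (t : ℝ) ^ (-p)) := by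
  have := hG.nonempty
  have : NeZero m := ⟨(Fin.pos (Classical.arbitrary (Fin m))).ne'⟩
  subst hη hβ hα
  obtain ⟨⟨i₀, hi₀⟩, hLub⟩ := hL
  have hL0 : 0 < L := hi₀ ▸ hLc i₀
  have hf : ∀ i, DGD.IsLSmooth L (f i) := fun i => (hsmooth i).mono (hLub ⟨i, rfl⟩)
  have hp0 := hp.1.le
  have hη0 : 0 < DGD.eta μ L := by
    unfold DGD.eta
    positivity
  have hβ0 := DGD.beta_nonneg W
  have hβ1 := hW.beta_lt_one hG
  have hαpos := DGD.stepsize_pos (p := p) ha hw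
  have hanti := DGD.stepsize_antitone ha hw hp0
  have hα2 : ∀ t, DGD.stepsize a w p t ≤ 2 / (μ + L) := fun t =>
    (hanti (Nat.zero_le t)).trans (hstep.trans (min_le_left _ _))
  have hηα : ∀ t, DGD.eta μ L * DGD.stepsize a w p t ≤ 1 := by
    intro t
    refine (mul_le_mul_of_nonneg_left (hα2 t) hη0.le).trans ?_
    rw [DGD.eta, div_mul_div_comm, div_le_one (by positivity)]
    nlinarith [sq_nonneg (μ - L), mul_pos hμ hL0]
  obtain ⟨xs, hmin⟩ := hconv.exists_isMinOn hμ (DGD.differentiable_totalCost fun i => (hf i).1)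
  have h0 := DGD.gradient_eq_zero_of_isMinOn hmin
  have hxs : ∀ t, x (t + 1) = DGD.step f W (DGD.stepsize a w p t) (x t) := fun t => by
    rw [hx]
    rfl
  have hA : ∀ t, DGD.optError (x (t + 1)) xs ≤
      (1 - DGD.eta μ L * DGD.stepsize a w p t) * DGD.optError (x t) xs +
        DGD.stepsize a w p t * L * DGD.consError (x t) := fun t => by
    rw [hxs t]
    exact DGD.optError_step_le hW.1 hL0 hμ hf hconv h0 (hαpos t).le (hα2 t) (hηα t) (x t)
  have hB : ∀ t, DGD.consError (x (t + 1)) ≤ DGD.beta W * DGD.consError (x t) +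
      DGD.stepsize a w p t * (L * (DGD.optError (x t) xs + DGD.consError (x t)) +
        √(m : ℝ) * DGD.gradMax f xs) := fun t => by
    rw [hxs t]
    exact (DGD.consError_step_le hW.1 (hαpos t).le (x t)).trans (add_le_add_right
      (mul_le_mul_of_nonneg_left (DGD.stackNorm_gradient_le hL0.le hf (x t) xs) (hαpos t).le) _)
  have hD : 0 ≤ DGD.gradMax f xs := Real.iSup_nonneg fun i => norm_nonneg _
  have hbound : ∃ R : ℝ, 0 < R ∧ DGD.IsUniformBound x xs R :=
    DGD.exists_bound_of_coupled_recursion (A := fun t => DGD.optError (x t) xs)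
      (B := fun t => DGD.consError (x t)) hη0 hL0 (mul_nonneg (Real.sqrt_nonneg _) hD) hαpos hanti
      (DGD.stepsize_one_lt ha hw hp.1) (hstep.trans (min_le_right _ _)) hβ0 hηα hA hB
  have hest : ∀ R, DGD.IsUniformBound x xs R → ∀ t : ℕ, 0 < ((t / 2 : ℕ) : ℝ) + w - 1 →
      DGD.optError (x t) xs ≤
        DGD.Q0 w p L (DGD.dConst m L R (DGD.gradMax f xs)) (DGD.eta μ L) * √(Real.exp 1) * a /
            (1 - DGD.beta W) * (((t / 2 : ℕ) : ℝ) + w - 1) ^ (-p)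
          + DGD.Y1 a w p (DGD.eta μ L) (DGD.totalError (x 0) xs) t
          + DGD.Y2 a w p (DGD.eta μ L) (DGD.beta W)
            (DGD.Q0 w p L (DGD.dConst m L R (DGD.gradMax f xs)) (DGD.eta μ L)) t
          + DGD.Y3 a w p (DGD.eta μ L) (DGD.beta W) L (DGD.R0 (DGD.consError (x 0))
            (DGD.dConst m L R (DGD.gradMax f xs)) (DGD.stepsize a w p 0) (DGD.beta W)) t := by
    intro R hR t ht
    have hR0 : 0 ≤ R := (DGD.optError_nonneg _ _).trans (hR 0).1
    have hd : 0 ≤ DGD.dConst m L R (DGD.gradMax f xs) := by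
      unfold DGD.dConst
      positivity
    refine DGD.optimality_estimate (A := fun t => DGD.optError (x t) xs)
      (B := fun t => DGD.consError (x t)) ha hw hp0 hη0 hηα hβ0 hβ1 hL0.le hd
      (DGD.optError_le_totalError _ _) (DGD.consError_nonneg _) hA (fun t => ?_) ht
      (DGD.totalError_nonneg _ _)
    -- Both errors are at most R, so the gradient term is at most 2LR + √m D = d.
    refine (hB t).trans (add_le_add_right (mul_le_mul_of_nonneg_left ?_ (hαpos t).le) _)
    unfold DGD.dConst
    have := mul_le_mul_of_nonneg_left (add_le_add (hR t).1 (hR t).2) hL0.le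
    linarith
  have hdecay : ∀ q₀ r₀ N : ℝ, (fun t : ℕ =>
      DGD.Y1 a w p (DGD.eta μ L) (DGD.totalError (x 0) xs) t
        + DGD.Y2 a w p (DGD.eta μ L) (DGD.beta W) q₀ t
        + DGD.Y3 a w p (DGD.eta μ L) (DGD.beta W) L r₀ t) =O[Filter.atTop]
      fun t : ℕ => (t : ℝ) ^ (-N) := fun q₀ r₀ N =>
    ((DGD.isBigO_Y1 ha hw hp0 hp.2 hη0 _ N).add (DGD.isBigO_Y2 ha hw hp0 hp.2 hη0 _ _ N)).add
      (DGD.isBigO_Y3 ha hw hp0 hp.2 hη0 hβ1 _ _ N)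
  refine ⟨xs, fun z => ⟨fun hz => hconv.eq_of_isMinOn hμ hz hmin, fun hz => hz ▸ hmin⟩, hbound,
    ?_, ?_⟩
  · rintro R d r₀ q₀ hR rfl rfl rfl
    refine ⟨hest R hR, fun N _ => ?_⟩
    -- On ℕ an asymptotic bound holds with one constant wherever the comparison function is nonzero,
    -- hence for all t ≥ 1.
    obtain ⟨C, hC, h⟩ := Asymptotics.bound_of_isBigO_nat_atTop (hdecay
      (DGD.Q0 w p L (DGD.dConst m L R (DGD.gradMax f xs)) (DGD.eta μ L))
      (DGD.R0 (DGD.consError (x 0)) (DGD.dConst m L R (DGD.gradMax f xs)) (DGD.stepsize a w p 0)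
        (DGD.beta W)) N)
    refine ⟨C, hC, fun t ht => ?_⟩
    have ht0 : 0 < (t : ℝ) ^ (-N) := Real.rpow_pos_of_pos (by exact_mod_cast ht) _
    have := h ht0.ne'
    rw [Real.norm_of_nonneg ht0.le] at this
    exact (Real.le_norm_self _).trans this
  · obtain ⟨R, -, hR⟩ := hbound
    have hmain := ((DGD.isBigO_half_rpow hw hp0).const_mul_left
      (DGD.Q0 w p L (DGD.dConst m L R (DGD.gradMax f xs)) (DGD.eta μ L) * √(Real.exp 1) * a /
        (1 - DGD.beta W))).add (hdecay
      (DGD.Q0 w p L (DGD.dConst m L R (DGD.gradMax f xs)) (DGD.eta μ L))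
      (DGD.R0 (DGD.consError (x 0)) (DGD.dConst m L R (DGD.gradMax f xs)) (DGD.stepsize a w p 0)
        (DGD.beta W)) p)
    refine Asymptotics.IsBigO.trans (Asymptotics.IsBigO.of_bound 1 ?_) hmain
    filter_upwards [Filter.eventually_ge_atTop 2] with t ht
    have hpos : 0 < ((t / 2 : ℕ) : ℝ) + w - 1 := by
      have h : 1 ≤ t / 2 := by omega
      have h : (1 : ℝ) ≤ (t / 2 : ℕ) := by exact_mod_cast h
      linarith
    rw [one_mul, Real.norm_of_nonneg (DGD.optError_nonneg _ _)]
    refine le_trans ?_ (Real.le_norm_self _)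
    have := hest R hR t hpos
    linarith
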